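/- Let $G=(V,E)$ be a finite, connected, simple graph embedded in the plane. Group of the graph. Let $M_G$ be the group generated by the phases $\{\pm1,\pm i\}$ (central, multiplying as usual), the vertices $v_j\in V$ and the directed edges $e_{ij}$ ($\{i,j\}\in E$), subject to: $e_{ij}^2=v_j^2=1$; $e_{ij}=-e_{ji}$; vertices commute with each other; $e_{ij}$ commutes with $v_k$ for $k\ne i,j$ and anticommutes with $v_j$; edges without a common vertex commute; and $e_{ij}e_{jk}=-e_{jk}e_{ij}$ for $k\neq i$. For a closed walk with $n$ directed edges $e_1,\dots,e_n$ consider the element $i^{\,n}e_1e_2\cdots e_n$ of $M_G$; these elements form the cycle group $\mathcal C_G\le M_G$. The *face cycle* of a bounded face is the element of $\mathcal C_G$ given by its boundary walk, and the *number of sides* of the face is the length of that walk. Encoding. A *fermionic encoding* is a representation $\sigma$ of $M_G$ on a system of qubits that takes values in the multi-qubit Pauli group, maps each phase to itself, and maps no element of $\mathcal C_G$ to $-1$. It is a *Weight 3 planar encoding* if: the qubits are one vertex qubit for each vertex, together with auxiliary qubits, each associated with one bounded face, at most one per face; $\sigma(v_j)$ is $Z$ on the qubit of $v_j$; and each $\sigma(e_{ij})$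 is, up to a phase, the product of an $X$ or $Y$ on each of the vertex qubits of $i$ and $j$ and of a Pauli $X$, $Y$ or $Z$ on at most one auxiliary qubit, belonging to a face adjacent to the edge $\{i,j\}$. Put $K:=\ker(\sigma|_{\mathcal C_G})$. Theorem. Let $\sigma$ be a Weight 3 planar encoding of $G$ such that every bounded face that carries an auxiliary qubit is bounded by a simple cycle of $G$ (its boundary walk repeats no vertex). Then $K$ is minimally generated by the face cycles (of bounded faces) that it contains: they generate $K$, no proper subset of them generates $K$, and no generating set of $K$ has fewer elements. Moreover, every bounded face whose face cycle lies in $K$ has 3 or 4 sides. -/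

import Mathlib

/-! ### Multi-qubit Pauli operators -/

/-- The labels of the four single-qubit Pauli operators. -/
inductive Pauli
  | I
  | X
  | Y
  | Z

/-- The `2 × 2` matrix of a single-qubit Pauli operator. -/
noncomputable def Pauli.toMatrix : Pauli → Matrix (Fin 2) (Fin 2) ℂ
  | Pauli.I => !![1, 0; 0, 1]
  | Pauli.X => !![0, 1; 1, 0]
  | Pauli.Y => !![0, -Complex.I; Complex.I, 0]
  | Pauli.Z => !![1, 0; 0, -1]

/-- Operators on the Hilbert space `(ℂ²)^{⊗ Q}` of qubits labelled by `Q`, as matrices in the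
computational basis `Q → Fin 2`. -/
abbrev QubitOp (Q : Type*) := Matrix (Q → Fin 2) (Q → Fin 2) ℂ

/-- The tensor product `⨂_q P q` of single-qubit Pauli operators. -/
noncomputable def pauliString {Q : Type*} [Fintype Q] (P : Q → Pauli) : QubitOp Q :=
  fun s t => ∏ q, (P q).toMatrix (s q) (t q)

/-- Membership in the multi-qubit Pauli group `{±1, ±i} × {I, X, Y, Z}^Q`. -/
def IsPauliOp {Q : Type*} [Fintype Q] (M : QubitOp Q) : Prop :=
  ∃ (k : ℕ) (P : Q → Pauli), M = Complex.I ^ k • pauliString P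

/-! ### The group of edge and vertex operators of a graph -/

/-- Generators of `M_G`: the phases `i ^ k`, the vertices and the directed edges of `G`. -/
inductive EVGen {V : Type*} (G : SimpleGraph V)
  | phase (k : ZMod 4)
  | vertex (v : V)
  | edge (d : G.Dart)

namespace EVGen

variable {V : Type*} (G : SimpleGraph V)

/-- The phase `i ^ k` as a word. -/
def ph (k : ZMod 4) : FreeGroup (EVGen G) := FreeGroup.of (EVGen.phase k)

/-- A vertex generator as a word. -/
def ve (v : V) : FreeGroup (EVGen G) := FreeGroup.of (EVGen.vertex v)

/-- A directed edge generator as a word. -/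
def ed (d : G.Dart) : FreeGroup (EVGen G) := FreeGroup.of (EVGen.edge d)

/-- The defining relations of `M_G`, as pairs of words to be identified.  The phases
`1, i, -1, -i` are `ph 0, ph 1, ph 2, ph 3`. -/
inductive Rel : FreeGroup (EVGen G) → FreeGroup (EVGen G) → Prop
  | phase_mul (k l : ZMod 4) : Rel (ph G k * ph G l) (ph G (k + l))
  | phase_central (k : ZMod 4) (g : EVGen G) :
      Rel (ph G k * FreeGroup.of g) (FreeGroup.of g * ph G k)
  | edge_sq (d : G.Dart) : Rel (ed G d * ed G d) 1
  | vertex_sq (v : V) : Rel (ve G v * ve G v) 1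
  | edge_symm (d : G.Dart) : Rel (ed G d) (ph G 2 * ed G d.symm)
  | vertex_comm (v w : V) : v ≠ w → Rel (ve G v * ve G w) (ve G w * ve G v)
  | edge_vertex_comm (d : G.Dart) (v : V) : v ≠ d.fst → v ≠ d.snd →
      Rel (ed G d * ve G v) (ve G v * ed G d)
  | edge_edge_comm (d d' : G.Dart) : d.fst ≠ d'.fst → d.fst ≠ d'.snd → d.snd ≠ d'.fst →
      d.snd ≠ d'.snd → Rel (ed G d * ed G d') (ed G d' * ed G d)
  | edge_vertex_anticomm (d : G.Dart) :
      Rel (ed G d * ve G d.snd) (ph G 2 * (ve G d.snd * ed G d))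
  | edge_edge_anticomm (d d' : G.Dart) : d.snd = d'.fst → d.fst ≠ d'.snd →
      Rel (ed G d * ed G d') (ph G 2 * (ed G d' * ed G d))

end EVGen

/-- The finitely presented group `M_G`. -/
abbrev EVGroup {V : Type*} (G : SimpleGraph V) :=
  PresentedGroup {r : FreeGroup (EVGen G) | ∃ x y, EVGen.Rel G x y ∧ r = x * y⁻¹}

namespace EVGroup

variable {V : Type*} (G : SimpleGraph V)

/-- The phase `i ^ k` in `M_G`. -/
def phase (k : ZMod 4) : EVGroup G := PresentedGroup.of (EVGen.phase k)

/-- The element of `M_G` given by a vertex. -/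
def vertex (v : V) : EVGroup G := PresentedGroup.of (EVGen.vertex v)

/-- The element `e_{ij}` of `M_G` given by a directed edge `(i, j)`. -/
def edge (d : G.Dart) : EVGroup G := PresentedGroup.of (EVGen.edge d)

/-- The element `i ^ n * e_1 * e_2 * ⋯ * e_n` given by a list of `n` directed edges. -/
def loopElement (l : List G.Dart) : EVGroup G :=
  phase G (l.length : ZMod 4) * (l.map (edge G)).prod

/-- The group `C_G` of directed cycles: the subgroup of `M_G` of the elements
`i ^ n * e_1 * ⋯ * e_n` given by the closed walks `e_1, …, e_n` of `G`.  (For connected `G` these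
elements already form a subgroup, so that taking the closure adds nothing.) -/
def cycleGroup : Subgroup (EVGroup G) :=
  Subgroup.closure {c | ∃ (u : V) (w : G.Walk u u), c = loopElement G w.darts}

end EVGroup

/-! ### Fermionic encodings -/

section Encoding

variable {V Q : Type*} [Fintype Q] [DecidableEq Q] {G : SimpleGraph V}

/-- A representation `σ` of `M_G` on qubits is a fermionic encoding if it takes values in the
Pauli group, represents the phases by themselves, and maps no directed cycle to `-1`. -/
structure IsFermionicEncoding (σ : EVGroup G →* QubitOp Q) : Prop where
  isPauliOp : ∀ m, IsPauliOp (σ m)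
  map_phase : ∀ k : ZMod 4, σ (EVGroup.phase G k) = Complex.I ^ k.val • (1 : QubitOp Q)
  map_cycle_ne : ∀ c ∈ EVGroup.cycleGroup G, σ c ≠ -1

/-- The kernel `K` of the restriction of `σ` to the group `C_G` of directed cycles. -/
def encodingKernel (σ : EVGroup G →* QubitOp Q) : Subgroup (EVGroup.cycleGroup G) :=
  (σ.comp (EVGroup.cycleGroup G).subtype).ker

end Encoding

/-! ### Plane graphs, as rotation systems of genus zero with a chosen outer face -/

/-- A rotation system: at every vertex, a cyclic order of the directed edges that leave it. -/
structure RotationSystem {V : Type*} (G : SimpleGraph V) where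
  /-- the next directed edge out of the same vertex -/
  rot : Equiv.Perm G.Dart
  rot_fst : ∀ d, (rot d).fst = d.fst
  rot_sameCycle : ∀ d d', d.fst = d'.fst → rot.SameCycle d d'

namespace RotationSystem

variable {V : Type*} {G : SimpleGraph V} (R : RotationSystem G)

/-- One step of the walk along the boundary of the face on a fixed side of a directed edge:
after `(u, v)`, leave `v` along the directed edge next to `(v, u)`. -/
def faceNext : Equiv.Perm G.Dart :=
  (Function.Involutive.toPerm SimpleGraph.Dart.symm SimpleGraph.Dart.symm_involutive).trans R.rot

/-- The faces: the orbits of `faceNext`.  An isolated vertex also has a face around it, which no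
directed edge bounds; in a connected graph this happens only if the graph is a single vertex. -/
def Face : Type _ :=
  Quotient (Equiv.Perm.SameCycle.setoid R.faceNext) ⊕ {v : V // ∀ w, ¬ G.Adj v w}

/-- The face whose boundary walk runs through the directed edge `d`. -/
def faceOf (d : G.Dart) : R.Face :=
  Sum.inl (Quotient.mk (Equiv.Perm.SameCycle.setoid R.faceNext) d)

/-- The edge of `d` is adjacent to the face `f`, i.e. `f` lies on one of its two sides. -/
def Adjacent (d : G.Dart) (f : R.Face) : Prop := R.faceOf d = f ∨ R.faceOf d.symm = f

/-- The number of sides of a face, i.e. the length of its boundary walk. -/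
noncomputable def sides (f : R.Face) : ℕ := Nat.card {d : G.Dart // R.faceOf d = f}

/-- The boundary walk of `f` visits no vertex twice. -/
def IsSimpleFace (f : R.Face) : Prop :=
  ∀ d d' : G.Dart, R.faceOf d = f → R.faceOf d' = f → d.fst = d'.fst → d = d'

/-- The boundary walk, started at the directed edge `d`, of the face `faceOf d`. -/
noncomputable def boundaryFrom (d : G.Dart) : List G.Dart :=
  List.iterate R.faceNext d (Function.minimalPeriod R.faceNext d)

/-- `c` is the face cycle of `f`, read from some starting point of its boundary walk. -/
def IsFaceCycle (f : R.Face) (c : EVGroup G) : Prop :=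
  ∃ d : G.Dart, R.faceOf d = f ∧ c = EVGroup.loopElement G (R.boundaryFrom d)

end RotationSystem

/-- A (combinatorial) embedding of a finite connected graph in the plane: a rotation system of
genus zero, by Euler's formula `|V| - |E| + |F| = 2`, with one face chosen as the unbounded one. -/
structure PlaneEmbedding {V : Type*} (G : SimpleGraph V) extends RotationSystem G where
  euler : Nat.card V + Nat.card toRotationSystem.Face = Nat.card G.edgeSet + 2
  /-- the unbounded face -/
  outer : toRotationSystem.Face

/-! ### Weight 3 planar encodings -/

/-- Weight 3 planar encodings.  The qubits are one vertex qubit for each element of `V` and the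
auxiliary qubits `A`; the auxiliary qubit `a` is associated with the bounded face `loc a`. -/
structure IsWeightThreePlanarEncoding {V A : Type*} [Fintype V] [DecidableEq V] [Fintype A]
    [DecidableEq A] {G : SimpleGraph V} (E : PlaneEmbedding G) (loc : A → E.Face)
    (σ : EVGroup G →* QubitOp (V ⊕ A)) : Prop extends IsFermionicEncoding σ where
  loc_bounded : ∀ a, loc a ≠ E.outer
  /-- every face has at most one auxiliary qubit -/
  loc_injective : Function.Injective loc
  vertex_op : ∀ v : V, σ (EVGroup.vertex G v) =
    pauliString (Function.update (fun _ => Pauli.I) (Sum.inl v) Pauli.Z)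
  edge_op : ∀ d : G.Dart, ∃ (k : ℕ) (P : V ⊕ A → Pauli),
    σ (EVGroup.edge G d) = Complex.I ^ k • pauliString P ∧
    (P (Sum.inl d.fst) = Pauli.X ∨ P (Sum.inl d.fst) = Pauli.Y) ∧
    (P (Sum.inl d.snd) = Pauli.X ∨ P (Sum.inl d.snd) = Pauli.Y) ∧
    (∀ v, v ≠ d.fst → v ≠ d.snd → P (Sum.inl v) = Pauli.I) ∧
    (∀ a, P (Sum.inr a) ≠ Pauli.I → E.Adjacent d (loc a)) ∧
    (∀ a b, P (Sum.inr a) ≠ Pauli.I → P (Sum.inr b) ≠ Pauli.I → a = b)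

/-- The set of the face cycles, of bounded faces, that lie in the kernel `K` of the encoding. -/
def kernelFaceCycles {V Q : Type*} [Fintype Q] [DecidableEq Q] {G : SimpleGraph V}
    (E : PlaneEmbedding G) (σ : EVGroup G →* QubitOp Q) : Set (EVGroup.cycleGroup G) :=
  {c | c ∈ encodingKernel σ ∧ ∃ f : E.Face, f ≠ E.outer ∧ E.IsFaceCycle f (c : EVGroup G)}

/-!
Up to phase, a Pauli operator on one qubit is a vector of `𝔽₂²`, and two of them commute if and only
if their symplectic product vanishes. The cycle group contains no phase but `1`, so it embeds into
the edge space `𝔽₂^E`. By Euler's formula every cycle is the boundary of a unique set `s` of bounded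
faces, and it lies in the kernel if and only if the Pauli vectors of its edges sum to zero.

Two consecutive directed edges anticommute, hence either their operators agree on the common vertex
qubit and anticommute on an auxiliary qubit, or the reverse. Suppose a turn of a face anticommutes
on the auxiliary qubit of that face: call it paired. Comparing, at every vertex, the sum of the
Pauli vectors of a kernel element with zero shows that the value of `s` on the face of a turn,
replaced by that of the face across the edge when the turn is paired, is the same for all turns. It
is `0` at the outer face, so every turn of a face in `s` is paired. Conversely, if every turn of a
face is paired then the operators around it cancel at every vertex, and consecutive edges
anticommute on the auxiliary qubit of the face, whereas the others commute there. As there are only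
three nontrivial Pauli operators, such a face is a triangle or a quadrilateral, and the auxiliary
operators cancel too. So the kernel is generated by the cycles of its faces, which are linearly
independent in `𝔽₂^E`.
-/

/-! ### Pauli operators up to phase -/

/-- Single-qubit Pauli operators up to phase: `(x, z)` stands for the class of `X ^ x * Z ^ z`. -/
abbrev PauliVec := ZMod 2 × ZMod 2

namespace PauliVec

/-- The symplectic form, which is `1` exactly at the pairs of anticommuting operators. -/
def symp (a b : PauliVec) : ZMod 2 := a.1 * b.2 + a.2 * b.1

variable (a b c : PauliVec)

theorem symp_self : a.symp a = 0 := by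
  revert a; decide

theorem symp_comm : a.symp b = b.symp a := by
  simp only [symp]; ring

theorem symp_add_left : (a + b).symp c = a.symp c + b.symp c := by
  simp only [symp, Prod.fst_add, Prod.snd_add]; ring

theorem zero_symp : symp 0 a = 0 := by simp [symp]

theorem symp_zero : symp a 0 = 0 := by simp [symp]

variable {a b c}

theorem ne_zero_of_symp_ne_zero (h : a.symp b ≠ 0) : a ≠ 0 ∧ b ≠ 0 :=
  ⟨fun ha => h (ha ▸ zero_symp b), fun hb => h (hb ▸ symp_zero a)⟩

theorem eq_of_symp_eq_zero (ha : a ≠ 0) (hb : b ≠ 0) (h : a.symp b = 0) : a = b := by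
  revert a b; decide

theorem eq_of_symp_eq_zero_of_fst (ha : a.1 = 1) (hb : b.1 = 1) (h : a.symp b = 0) : a = b := by
  revert a b; decide

theorem add_add_eq_zero_of_symp_eq_one (hab : a.symp b = 1) (hbc : b.symp c = 1)
    (hca : c.symp a = 1) : a + b + c = 0 := by
  revert a b c; decide

/-- Among `0` and the letters `X`, `Y`, the linear functional `b ↦ b.1 + a.symp b` detects the
letter `a`. -/
theorem fst_add_symp_eq_ite (ha : a.1 = 1) (hb : b = 0 ∨ b.1 = 1) :
    b.1 + a.symp b = if b = a then 1 else 0 := by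
  revert a b; decide

end PauliVec

namespace Pauli

/-- The class of a Pauli operator up to phase. -/
def vec : Pauli → PauliVec
  | I => (0, 0)
  | X => (1, 0)
  | Y => (1, 1)
  | Z => (0, 1)

theorem vec_surjective : Function.Surjective vec := by
  intro a
  fin_cases a
  exacts [⟨I, rfl⟩, ⟨Z, rfl⟩, ⟨X, rfl⟩, ⟨Y, rfl⟩]

theorem vec_eq_zero_iff {P : Pauli} : P.vec = 0 ↔ P = I := by
  cases P <;> simp [vec, Prod.ext_iff]

end Pauli

theorem addChar_map_sum {ι A M : Type*} [AddCommMonoid A] [CommMonoid M] (ψ : AddChar A M)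
    (s : Finset ι) (f : ι → A) : ψ (∑ i ∈ s, f i) = ∏ i ∈ s, ψ (f i) :=
  map_prod ψ.toMonoidHom (fun i => Multiplicative.ofAdd (f i)) s

/-- The character of `ℤ/2` with values `1` and `-1`. -/
noncomputable def signChar : AddChar (ZMod 2) ℂ := AddChar.zmodChar 2 neg_one_sq

theorem signChar_zero : signChar 0 = 1 := AddChar.map_zero_eq_one _

theorem signChar_one : signChar 1 = -1 := by
  simp [signChar, AddChar.zmodChar_apply, ZMod.val_one]

theorem signChar_injective : Function.Injective signChar := by
  have zero_or_one : ∀ a : ZMod 2, a = 0 ∨ a = 1 := by decide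
  intro a b h
  rcases zero_or_one a with rfl | rfl <;> rcases zero_or_one b with rfl | rfl <;>
    first | rfl | norm_num [signChar_zero, signChar_one] at h

section SympForm

variable {Q : Type*} [Fintype Q]

/-- The symplectic form on multi-qubit Pauli operators up to phase. -/
def sympForm (u w : Q → PauliVec) : ZMod 2 := ∑ q, (u q).symp (w q)

theorem sympForm_add_left (u u' w : Q → PauliVec) :
    sympForm (u + u') w = sympForm u w + sympForm u' w := by
  simp only [sympForm, Pi.add_apply, PauliVec.symp_add_left, Finset.sum_add_distrib]

theorem sympForm_eq_symp_of_forall_ne {u w : Q → PauliVec} (q : Q)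
    (h : ∀ q' ≠ q, (u q').symp (w q') = 0) : sympForm u w = (u q).symp (w q) :=
  Finset.sum_eq_single q (fun q' _ => h q') fun hq => (hq (Finset.mem_univ q)).elim

end SympForm
theorem exists_vec_comp_eq {Q : Type*} (u : Q → PauliVec) :
    ∃ S : Q → Pauli, (fun q => (S q).vec) = u :=
  ⟨fun q => Function.surjInv Pauli.vec_surjective (u q),
    funext fun q => Function.surjInv_eq Pauli.vec_surjective (u q)⟩

section PauliOps

variable {Q : Type*} [Fintype Q]

theorem eq_of_sympForm_eq {u u' : Q → PauliVec}
    (h : ∀ w, sympForm u w = sympForm u' w) : u = u' := by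
  classical
  have symp_eq (q : Q) (a : PauliVec) : (u q).symp a = (u' q).symp a := by
    have sympForm_single (v : Q → PauliVec) : sympForm v (Pi.single q a) = (v q).symp a := by
      rw [sympForm_eq_symp_of_forall_ne q, Pi.single_eq_same]
      intro q' hq'
      rw [Pi.single_eq_of_ne hq', PauliVec.symp_zero]
    rw [← sympForm_single, ← sympForm_single, h]
  funext q
  ext
  · simpa [PauliVec.symp] using symp_eq q (0, 1)
  · simpa [PauliVec.symp] using symp_eq q (1, 0)

/-- The tensor product of single-qubit operators. -/
def tensorOp (M : Q → Matrix (Fin 2) (Fin 2) ℂ) : QubitOp Q := fun s t => ∏ q, M q (s q) (t q)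

theorem pauliString_eq_tensorOp (P : Q → Pauli) :
    pauliString P = tensorOp fun q => (P q).toMatrix := rfl

theorem tensorOp_smul (c : Q → ℂ) (M : Q → Matrix (Fin 2) (Fin 2) ℂ) :
    (tensorOp fun q => c q • M q) = (∏ q, c q) • tensorOp M := by
  ext s t
  simp [tensorOp, Finset.prod_mul_distrib]

theorem tensorOp_one : (tensorOp fun _ => 1 : QubitOp Q) = 1 := by
  ext s t
  simp only [tensorOp, Matrix.one_apply]
  split_ifs with h
  · simp [h]
  · obtain ⟨q, hq⟩ := Function.ne_iff.1 h
    exact Finset.prod_eq_zero (Finset.mem_univ q) (if_neg hq)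

theorem Pauli.toMatrix_I : Pauli.I.toMatrix = 1 := Matrix.one_fin_two.symm

theorem pauliString_I : (pauliString fun _ => Pauli.I : QubitOp Q) = 1 := by
  simp only [pauliString_eq_tensorOp, Pauli.toMatrix_I, tensorOp_one]

variable [DecidableEq Q]

theorem tensorOp_mul (M N : Q → Matrix (Fin 2) (Fin 2) ℂ) :
    tensorOp M * tensorOp N = tensorOp fun q => M q * N q := by
  ext s t
  simp only [tensorOp, Matrix.mul_apply, ← Finset.prod_mul_distrib]
  rw [Finset.prod_univ_sum, Fintype.piFinset_univ]

theorem Pauli.toMatrix_mul_self (P : Pauli) : P.toMatrix * P.toMatrix = 1 := by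
  cases P <;> simp [Pauli.toMatrix, Matrix.one_fin_two]

theorem Pauli.toMatrix_mul_comm (P S : Pauli) :
    P.toMatrix * S.toMatrix = signChar (P.vec.symp S.vec) • (S.toMatrix * P.toMatrix) := by
  cases P <;> cases S <;>
    simp [Pauli.toMatrix, Pauli.vec, PauliVec.symp, signChar_one,
      CharTwo.add_self_eq_zero]

theorem pauliString_mul_self (P : Q → Pauli) : pauliString P * pauliString P = 1 := by
  simp only [pauliString_eq_tensorOp, tensorOp_mul, Pauli.toMatrix_mul_self, tensorOp_one]

theorem pauliString_isUnit (P : Q → Pauli) : IsUnit (pauliString P) :=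
  IsUnit.of_mul_eq_one _ (pauliString_mul_self P)

theorem pauliString_mul_comm (P S : Q → Pauli) :
    pauliString P * pauliString S =
      signChar (sympForm (fun q => (P q).vec) fun q => (S q).vec) •
        (pauliString S * pauliString P) := by
  have toMatrix_mul_comm := funext fun q => (P q).toMatrix_mul_comm (S q)
  simp only [pauliString_eq_tensorOp, tensorOp_mul, sympForm, addChar_map_sum, ← tensorOp_smul,
    toMatrix_mul_comm]

/-- `M` commutes with every Pauli string up to the sign prescribed by the class `u`. For a
multi-qubit Pauli operator this determines `u`, so that no multiplication table is needed to see
that the class of a product is the sum of the classes. -/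
def HasPauliVec (M : QubitOp Q) (u : Q → PauliVec) : Prop :=
  ∀ S : Q → Pauli, M * pauliString S =
    signChar (sympForm u fun q => (S q).vec) • (pauliString S * M)

theorem hasPauliVec_pauliString (P : Q → Pauli) :
    HasPauliVec (pauliString P) fun q => (P q).vec :=
  pauliString_mul_comm P

namespace HasPauliVec

variable {M N : QubitOp Q} {u w : Q → PauliVec}

theorem smul (c : ℂ) (hM : HasPauliVec M u) : HasPauliVec (c • M) u := fun S => by
  rw [Matrix.smul_mul, Matrix.mul_smul, hM S, smul_comm]

theorem mul (hM : HasPauliVec M u) (hN : HasPauliVec N w) : HasPauliVec (M * N) (u + w) :=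
  fun S => by
  rw [mul_assoc, hN S, Matrix.mul_smul, ← mul_assoc, hM S, Matrix.smul_mul, smul_smul,
    ← AddChar.map_add_eq_mul, sympForm_add_left, add_comm, mul_assoc]

theorem sympForm_eq (hM : HasPauliVec M u) (hMu : IsUnit M) {S : Q → Pauli} {a : ZMod 2}
    (h : M * pauliString S = signChar a • (pauliString S * M)) :
    sympForm u (fun q => (S q).vec) = a :=
  signChar_injective <|
    smul_left_injective ℂ ((pauliString_isUnit S).mul hMu).ne_zero ((hM S).symm.trans h)

theorem unique (hM : HasPauliVec M u) (hMw : HasPauliVec M w) (hMu : IsUnit M) : u = w := by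
  refine eq_of_sympForm_eq fun v => ?_
  obtain ⟨S, rfl⟩ := exists_vec_comp_eq v
  exact hM.sympForm_eq hMu (hMw S)

end HasPauliVec

theorem IsPauliOp.exists_hasPauliVec {M : QubitOp Q} (hM : IsPauliOp M) :
    ∃ u, HasPauliVec M u := by
  obtain ⟨k, P, rfl⟩ := hM
  exact ⟨_, (hasPauliVec_pauliString P).smul _⟩

variable {H : Type*} [Group H] {σ : H →* QubitOp Q} (hσ : ∀ m, IsPauliOp (σ m))

theorem isUnit_map (σ : H →* QubitOp Q) (m : H) : IsUnit (σ m) := (Group.isUnit m).map σ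

/-- The class up to phase of the operators of a representation by Pauli operators. -/
noncomputable def pauliVecHom : Additive H →+ (Q → PauliVec) :=
  AddMonoidHom.mk' (fun m => (hσ m.toMul).exists_hasPauliVec.choose) fun m n => by
    have hspec (m : Additive H) := (hσ m.toMul).exists_hasPauliVec.choose_spec
    refine (hspec (m + n)).unique ?_ (isUnit_map σ _)
    rw [toMul_add, map_mul]
    exact (hspec m).mul (hspec n)

theorem hasPauliVec_pauliVecHom (m : H) :
    HasPauliVec (σ m) (pauliVecHom hσ (Additive.ofMul m)) :=
  (hσ m).exists_hasPauliVec.choose_spec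

theorem pauliVecHom_eq {m : H} {c : ℂ} {P : Q → Pauli} (h : σ m = c • pauliString P) :
    pauliVecHom hσ (Additive.ofMul m) = fun q => (P q).vec := by
  refine (hasPauliVec_pauliVecHom hσ m).unique ?_ (isUnit_map σ m)
  rw [h]
  exact (hasPauliVec_pauliString P).smul c

theorem sympForm_pauliVecHom {m n : H} {a : ZMod 2}
    (h : σ m * σ n = signChar a • (σ n * σ m)) :
    sympForm (pauliVecHom hσ (Additive.ofMul m)) (pauliVecHom hσ (Additive.ofMul n)) = a := by
  obtain ⟨k, P, hP⟩ := hσ n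
  have hI : Complex.I ^ k ≠ 0 := pow_ne_zero k Complex.I_ne_zero
  rw [pauliVecHom_eq hσ hP]
  refine (hasPauliVec_pauliVecHom hσ m).sympForm_eq (isUnit_map σ m) ?_
  rwa [hP, Matrix.mul_smul, Matrix.smul_mul, smul_comm, smul_right_inj hI] at h

theorem exists_eq_smul_one_of_pauliVecHom_eq_zero {m : H}
    (h : pauliVecHom hσ (Additive.ofMul m) = 0) :
    ∃ k : ℕ, σ m = Complex.I ^ k • (1 : QubitOp Q) := by
  obtain ⟨k, P, hP⟩ := hσ m
  rw [pauliVecHom_eq hσ hP] at h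
  obtain rfl : P = fun _ => Pauli.I := funext fun q => Pauli.vec_eq_zero_iff.1 (congrFun h q)
  exact ⟨k, by rw [hP, pauliString_I]⟩

theorem pauliVecHom_eq_zero {m : H} {c : ℂ} (h : σ m = c • (1 : QubitOp Q)) :
    pauliVecHom hσ (Additive.ofMul m) = 0 := by
  rw [← pauliString_I] at h
  exact pauliVecHom_eq hσ h

end PauliOps

/-! ### The class of a loop modulo two -/

theorem commute_map_of_closure_eq_top {H K : Type*} [Group H] [Group K] (f : H →* K) {S : Set H}
    (hS : Subgroup.closure S = ⊤) (hcomm : ∀ x ∈ S, ∀ y ∈ S, Commute (f x) (f y)) (x y : H) :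
    Commute (f x) (f y) := by
  have mem_closure (z : H) : z ∈ Subgroup.closure S := hS ▸ Subgroup.mem_top z
  refine Subgroup.closure_induction₂ (p := fun x y _ _ => Commute (f x) (f y))
    (fun x y hx hy => hcomm x hx y hy) ?_ ?_ ?_ ?_ ?_ ?_ (mem_closure x) (mem_closure y) <;>
    intros <;>
    simp_all only [map_one, map_mul, map_inv, Commute.one_left, Commute.one_right,
      Commute.mul_left, Commute.mul_right, Commute.inv_left, Commute.inv_right]

namespace EVGroup

variable {V : Type*} {G : SimpleGraph V}

theorem mk_eq_of_rel {x y : FreeGroup (EVGen G)} (h : EVGen.Rel G x y) :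
    (PresentedGroup.mk _ x : EVGroup G) = PresentedGroup.mk _ y :=
  PresentedGroup.mk_eq_mk_of_mul_inv_mem ⟨x, y, h, rfl⟩

theorem phase_mul (k l : ZMod 4) : phase G k * phase G l = phase G (k + l) :=
  mk_eq_of_rel (.phase_mul k l)

theorem phase_zero : phase G 0 = 1 := by
  simpa using phase_mul (G := G) 0 0

theorem phase_commute (k : ZMod 4) (x : EVGroup G) : Commute (phase G k) x := by
  refine PresentedGroup.generated_by _ (Subgroup.centralizer {phase G k})
    (fun g => Subgroup.mem_centralizer_singleton_iff.2 ?_) x |>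
    Subgroup.mem_centralizer_singleton_iff.1 |> Eq.symm
  exact (mk_eq_of_rel (.phase_central k g)).symm

theorem edge_mul_self (d : G.Dart) : edge G d * edge G d = 1 := mk_eq_of_rel (.edge_sq d)

theorem vertex_mul_self (v : V) : vertex G v * vertex G v = 1 := mk_eq_of_rel (.vertex_sq v)

theorem edge_eq_phase_mul_symm (d : G.Dart) : edge G d = phase G 2 * edge G d.symm :=
  mk_eq_of_rel (.edge_symm d)

theorem vertex_commute (v w : V) : Commute (vertex G v) (vertex G w) := by
  obtain rfl | h := eq_or_ne v w
  · exact Commute.refl _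
  · exact mk_eq_of_rel (.vertex_comm v w h)

theorem edge_commute {d d' : G.Dart} (h₁ : d.fst ≠ d'.fst) (h₂ : d.fst ≠ d'.snd)
    (h₃ : d.snd ≠ d'.fst) (h₄ : d.snd ≠ d'.snd) : Commute (edge G d) (edge G d') :=
  mk_eq_of_rel (.edge_edge_comm d d' h₁ h₂ h₃ h₄)

theorem edge_mul_edge_of_snd_eq_fst {d d' : G.Dart} (h : d.snd = d'.fst) (h' : d.fst ≠ d'.snd) :
    edge G d * edge G d' = phase G 2 * (edge G d' * edge G d) :=
  mk_eq_of_rel (.edge_edge_anticomm d d' h h')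

/-- The central subgroup of phases. -/
def phaseSubgroup (G : SimpleGraph V) : Subgroup (EVGroup G) where
  carrier := Set.range (phase G)
  one_mem' := ⟨0, phase_zero⟩
  mul_mem' := by
    rintro _ _ ⟨k, rfl⟩ ⟨l, rfl⟩
    exact ⟨k + l, (phase_mul k l).symm⟩
  inv_mem' := by
    rintro _ ⟨k, rfl⟩
    exact ⟨-k, eq_inv_of_mul_eq_one_left (by rw [phase_mul, neg_add_cancel, phase_zero])⟩

instance : (phaseSubgroup G).Normal where
  conj_mem := by
    rintro _ ⟨k, rfl⟩ x
    exact ⟨k, by rw [← (phase_commute k x).eq, mul_inv_cancel_right]⟩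

theorem mk_phase_mul (k : ZMod 4) (x : EVGroup G) :
    ((phase G k * x : EVGroup G) : EVGroup G ⧸ phaseSubgroup G) = x := by
  rw [QuotientGroup.mk_mul, (QuotientGroup.eq_one_iff (phase G k)).2 (Set.mem_range_self k),
    one_mul]

theorem mk_edge_symm (d : G.Dart) :
    (edge G d.symm : EVGroup G ⧸ phaseSubgroup G) = edge G d := by
  rw [edge_eq_phase_mul_symm d, mk_phase_mul]

theorem mk_edge_commute_mk_edge (d d' : G.Dart) :
    Commute (edge G d : EVGroup G ⧸ phaseSubgroup G) (edge G d') := by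
  have of_snd_eq_fst {d d' : G.Dart} (h : d.snd = d'.fst) :
      Commute (edge G d : EVGroup G ⧸ phaseSubgroup G) (edge G d') := by
    by_cases h' : d.fst = d'.snd
    · obtain rfl : d' = d.symm := SimpleGraph.Dart.ext _ _ (Prod.ext h.symm h'.symm)
      rw [mk_edge_symm]
    · rw [Commute, SemiconjBy, ← QuotientGroup.mk_mul, edge_mul_edge_of_snd_eq_fst h h',
        mk_phase_mul, QuotientGroup.mk_mul]
  by_cases h₃ : d.snd = d'.fst
  · exact of_snd_eq_fst h₃
  by_cases h₁ : d.fst = d'.fst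
  · exact mk_edge_symm d ▸ of_snd_eq_fst (d := d.symm) h₁
  by_cases h₄ : d.snd = d'.snd
  · exact mk_edge_symm d' ▸ of_snd_eq_fst (d' := d'.symm) h₄
  by_cases h₂ : d.fst = d'.snd
  · exact (of_snd_eq_fst h₂.symm).symm
  · exact (edge_commute h₁ h₂ h₃ h₄).map (QuotientGroup.mk' _)

theorem mk_edge_commute_mk_vertex (d : G.Dart) (v : V) :
    Commute (edge G d : EVGroup G ⧸ phaseSubgroup G) (vertex G v) := by
  have of_snd (d : G.Dart) :
      Commute (edge G d : EVGroup G ⧸ phaseSubgroup G) (vertex G d.snd) := by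
    have anticomm : edge G d * vertex G d.snd = phase G 2 * (vertex G d.snd * edge G d) :=
      mk_eq_of_rel (.edge_vertex_anticomm d)
    rw [Commute, SemiconjBy, ← QuotientGroup.mk_mul, anticomm, mk_phase_mul, QuotientGroup.mk_mul]
  by_cases h₂ : v = d.snd
  · exact h₂ ▸ of_snd d
  by_cases h₁ : v = d.fst
  · exact mk_edge_symm d ▸ h₁ ▸ of_snd d.symm
  · have comm : Commute (edge G d) (vertex G v) := mk_eq_of_rel (.edge_vertex_comm d v h₁ h₂)
    exact comm.map (QuotientGroup.mk' _)

theorem mk_commute_mk (x y : EVGroup G) :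
    Commute (x : EVGroup G ⧸ phaseSubgroup G) y := by
  have of_generators (g g' : EVGen G) : Commute (QuotientGroup.mk' (phaseSubgroup G)
      (PresentedGroup.of g)) (QuotientGroup.mk' (phaseSubgroup G) (PresentedGroup.of g')) := by
    cases g with
    | phase k => exact (phase_commute k _).map (QuotientGroup.mk' _)
    | vertex v =>
      cases g' with
      | phase k => exact (phase_commute k _).symm.map (QuotientGroup.mk' _)
      | vertex w => exact (vertex_commute v w).map (QuotientGroup.mk' _)
      | edge d => exact (mk_edge_commute_mk_vertex d v).symm
    | edge d =>
      cases g' with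
      | phase k => exact (phase_commute k _).symm.map (QuotientGroup.mk' _)
      | vertex v => exact mk_edge_commute_mk_vertex d v
      | edge d' => exact mk_edge_commute_mk_edge d d'
  refine commute_map_of_closure_eq_top (QuotientGroup.mk' _)
    (PresentedGroup.closure_range_of _) ?_ x y
  rintro _ ⟨g, rfl⟩ _ ⟨g', rfl⟩
  exact of_generators g g'

theorem mk_mul_self (x : EVGroup G) : (x * x : EVGroup G ⧸ phaseSubgroup G) = 1 := by
  have hx : x ∈ Subgroup.closure (Set.range PresentedGroup.of) :=
    PresentedGroup.closure_range_of _ ▸ Subgroup.mem_top x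
  induction hx using Subgroup.closure_induction with
  | mem y hy =>
    obtain ⟨g | v | d, rfl⟩ := hy
    · exact (QuotientGroup.eq_one_iff _).2 ⟨g + g, (phase_mul g g).symm⟩
    · exact congrArg _ (vertex_mul_self v)
    · exact congrArg _ (edge_mul_self d)
  | one => rw [QuotientGroup.mk_one, one_mul]
  | mul y z _ _ hy hz =>
    rw [QuotientGroup.mk_mul, (mk_commute_mk z y).mul_mul_mul_comm, hy, hz, one_mul]
  | inv y _ hy => rw [QuotientGroup.mk_inv, ← mul_inv_rev, hy, inv_one]

end EVGroup

section EdgeClass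

variable {V : Type*} {G : SimpleGraph V}

/-- The undirected edge of a directed edge. -/
def dartEdge (d : G.Dart) : G.edgeSet := ⟨d.edge, d.edge_mem⟩

theorem dartEdge_symm (d : G.Dart) : dartEdge d.symm = dartEdge d :=
  Subtype.ext d.edge_symm

theorem dartEdge_eq_iff {d d' : G.Dart} : dartEdge d = dartEdge d' ↔ d = d' ∨ d = d'.symm := by
  rw [Subtype.ext_iff]
  exact SimpleGraph.dart_edge_eq_iff d d'

theorem dartEdge_surjective : Function.Surjective (dartEdge (G := G)) := by
  rintro ⟨⟨u, v⟩, h⟩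
  exact ⟨⟨(u, v), h⟩, rfl⟩

/-- An arbitrary choice of a direction for each edge. -/
noncomputable def edgeDart : G.edgeSet → G.Dart := Function.surjInv dartEdge_surjective

theorem dartEdge_edgeDart (e : G.edgeSet) : dartEdge (edgeDart e) = e :=
  Function.surjInv_eq dartEdge_surjective e

theorem edgeDart_dartEdge (d : G.Dart) :
    edgeDart (dartEdge d) = d ∨ edgeDart (dartEdge d) = d.symm :=
  dartEdge_eq_iff.1 (dartEdge_edgeDart _)

open scoped Classical in
/-- The edge of `d` as an element of the space of sets of edges modulo two. -/
noncomputable def dartVec (d : G.Dart) : G.edgeSet → ZMod 2 := Pi.single (dartEdge d) 1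

theorem dartVec_symm (d : G.Dart) : dartVec d.symm = dartVec d := by
  rw [dartVec, dartEdge_symm, dartVec]

open scoped Classical in
theorem dartVec_dartEdge (d x : G.Dart) :
    dartVec d (dartEdge x) = (if x = d then 1 else 0) + (if x.symm = d then 1 else 0) := by
  simp only [dartVec, Pi.single_apply, dartEdge_eq_iff,
    ← SimpleGraph.Dart.symm_involutive.eq_iff (x := x)]
  by_cases h : x = d
  · simp [h, d.symm_ne]
  · simp [h]

open EVGroup

/-- The set of the edges that occur an odd number of times in an element of `M_G`. -/
noncomputable def edgeClass (G : SimpleGraph V) :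
    Additive (EVGroup G) →+ (G.edgeSet → ZMod 2) :=
  MonoidHom.toAdditiveLeft <| PresentedGroup.toGroup
    (f := fun g => match g with
      | .phase _ => 1
      | .vertex _ => 1
      | .edge d => Multiplicative.ofAdd (dartVec d)) <| by
    rintro _ ⟨x, y, h, rfl⟩
    rw [map_mul, map_inv, mul_inv_eq_one]
    cases h with
    | phase_mul k l => simp [EVGen.ph]
    | edge_sq d => simp [EVGen.ed, ← ofAdd_add, ZModModule.add_self]
    | vertex_sq v => simp [EVGen.ve]
    | edge_symm d => simp [EVGen.ed, EVGen.ph, dartVec_symm]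
    | edge_vertex_anticomm d => simp [EVGen.ed, EVGen.ph, EVGen.ve]
    | edge_edge_anticomm d d' => simp [EVGen.ed, EVGen.ph, mul_comm]
    | _ => rw [map_mul, map_mul, mul_comm]

theorem edgeClass_phase (k : ZMod 4) : edgeClass G (.ofMul (phase G k)) = 0 := by
  rw [edgeClass, phase, MonoidHom.coe_toAdditiveLeft, Function.comp_apply, Function.comp_apply,
    toMul_ofMul, PresentedGroup.toGroup.of, toAdd_one]

theorem edgeClass_edge (d : G.Dart) : edgeClass G (.ofMul (edge G d)) = dartVec d := by
  rw [edgeClass, edge, MonoidHom.coe_toAdditiveLeft, Function.comp_apply, Function.comp_apply,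
    toMul_ofMul, PresentedGroup.toGroup.of, toAdd_ofAdd]

section Factor

variable {N : Type*} [AddCommGroup N] {ψ : Additive (EVGroup G) →+ N}

theorem map_loopElement (hψ : ∀ k, ψ (.ofMul (phase G k)) = 0) (l : List G.Dart) :
    ψ (.ofMul (loopElement G l)) = (l.map fun d => ψ (.ofMul (edge G d))).sum := by
  rw [loopElement, ofMul_mul, map_add, hψ, zero_add, ofMul_list_prod, map_list_sum,
    List.map_map, List.map_map]
  rfl

theorem map_edge_symm (hψ : ∀ k, ψ (.ofMul (phase G k)) = 0) (d : G.Dart) :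
    ψ (.ofMul (edge G d.symm)) = ψ (.ofMul (edge G d)) := by
  rw [edge_eq_phase_mul_symm d, ofMul_mul, map_add, hψ, zero_add]

theorem map_edge_edgeDart (hψ : ∀ k, ψ (.ofMul (phase G k)) = 0) (d : G.Dart) :
    ψ (.ofMul (edge G (edgeDart (dartEdge d)))) = ψ (.ofMul (edge G d)) := by
  obtain h | h := edgeDart_dartEdge d <;> rw [h]
  exact map_edge_symm hψ d

variable [Finite G.edgeSet] [Module (ZMod 2) N]

/-- The map on sets of edges modulo two through which a homomorphism that kills the phases factors
on loops. -/
noncomputable def edgeLinear (ψ : Additive (EVGroup G) →+ N) :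
    (G.edgeSet → ZMod 2) →ₗ[ZMod 2] N :=
  (Pi.basisFun (ZMod 2) G.edgeSet).constr ℕ fun e => ψ (.ofMul (edge G (edgeDart e)))

theorem edgeLinear_dartVec (hψ : ∀ k, ψ (.ofMul (phase G k)) = 0) (d : G.Dart) :
    edgeLinear ψ (dartVec d) = ψ (.ofMul (edge G d)) := by
  rw [dartVec, ← Pi.basisFun_apply, edgeLinear, Module.Basis.constr_basis, map_edge_edgeDart hψ]

theorem edgeLinear_edgeClass (hψ : ∀ k, ψ (.ofMul (phase G k)) = 0) {c : EVGroup G}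
    (hc : c ∈ cycleGroup G) : edgeLinear ψ (edgeClass G (.ofMul c)) = ψ (.ofMul c) := by
  induction hc using Subgroup.closure_induction with
  | mem x hx =>
    obtain ⟨u, w, rfl⟩ := hx
    rw [map_loopElement hψ, map_loopElement edgeClass_phase, map_list_sum, List.map_map]
    congr 2
    funext d
    rw [Function.comp_apply, edgeClass_edge, edgeLinear_dartVec hψ]
  | one => rw [ofMul_one, map_zero, map_zero, map_zero]
  | mul x y _ _ hx hy => rw [ofMul_mul, map_add, map_add, map_add, hx, hy]
  | inv x _ hx => rw [ofMul_inv, map_neg, map_neg, map_neg, hx]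

end Factor

theorem exists_phase_of_edgeClass_eq_zero [Finite G.edgeSet] {c : EVGroup G}
    (hc : c ∈ cycleGroup G) (h : edgeClass G (.ofMul c) = 0) : ∃ k, phase G k = c := by
  let : CommGroup (EVGroup G ⧸ phaseSubgroup G) :=
    { (inferInstance : Group (EVGroup G ⧸ phaseSubgroup G)) with
      mul_comm := by
        rintro ⟨x⟩ ⟨y⟩
        exact mk_commute_mk x y }
  let : Module (ZMod 2) (Additive (EVGroup G ⧸ phaseSubgroup G)) :=
    AddCommGroup.zmodModule fun x => by
      obtain ⟨y, hy⟩ := QuotientGroup.mk_surjective x.toMul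
      rw [two_nsmul, ← ofMul_toMul x, ← hy, ← ofMul_mul, mk_mul_self, ofMul_one]
  let ψ : Additive (EVGroup G) →+ Additive (EVGroup G ⧸ phaseSubgroup G) :=
    MonoidHom.toAdditive (QuotientGroup.mk' _)
  have hψ (k : ZMod 4) : ψ (.ofMul (phase G k)) = 0 :=
    (QuotientGroup.eq_one_iff (phase G k)).2 (Set.mem_range_self k)
  have hmk := edgeLinear_edgeClass hψ hc
  rw [h, map_zero] at hmk
  exact (QuotientGroup.eq_one_iff c).1 hmk.symm

/-- The class modulo two of a directed cycle. -/
noncomputable def cycleClass (G : SimpleGraph V) :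
    Additive (cycleGroup G) →+ (G.edgeSet → ZMod 2) :=
  (edgeClass G).comp (MonoidHom.toAdditive (cycleGroup G).subtype)

theorem cycleClass_ofMul (c : cycleGroup G) :
    cycleClass G (.ofMul c) = edgeClass G (.ofMul (c : EVGroup G)) := rfl

theorem cycleClass_injective [Finite G.edgeSet] (h : phase G 2 ∉ cycleGroup G) :
    Function.Injective (cycleClass G) := by
  refine (injective_iff_map_eq_zero _).2 fun c hc => ?_
  obtain ⟨k, hk⟩ := exists_phase_of_edgeClass_eq_zero c.toMul.2 hc
  suffices k = 0 from Subtype.ext (hk.symm.trans (this ▸ phase_zero))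
  have hkC : phase G k ∈ cycleGroup G := hk ▸ c.toMul.2
  have hkkC : phase G (k + k) ∈ cycleGroup G := phase_mul k k ▸ mul_mem hkC hkC
  have zero_or_two : ∀ m : ZMod 4, m = 0 ∨ m = 2 ∨ m + m = 2 := by decide
  rcases zero_or_two k with h0 | h2 | h2
  · exact h0
  · exact (h (h2 ▸ hkC)).elim
  · exact (h (h2 ▸ hkkC)).elim

end EdgeClass

/-! ### Faces and their boundary walks -/

theorem apply_eq_of_sameCycle {α β : Type*} {f : Equiv.Perm α} {t : α → β}
    (ht : ∀ x, t (f x) = t x) {x y : α} (h : f.SameCycle x y) : t x = t y := by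
  obtain ⟨n, rfl⟩ := h
  induction n with
  | zero => rfl
  | succ n ih => rw [add_comm, zpow_add, zpow_one, Equiv.Perm.mul_apply, ht, ih]
  | pred n ih =>
    rw [ih, ← ht ((f ^ (-(n : ℤ) - 1)) x), ← Equiv.Perm.mul_apply, ← zpow_one_add, add_sub_cancel]

instance finite_dart {V : Type*} [Finite V] (G : SimpleGraph V) : Finite G.Dart :=
  Finite.of_injective _ SimpleGraph.Dart.toProd_injective

namespace RotationSystem

variable {V : Type*} {G : SimpleGraph V} (R : RotationSystem G)

instance [Finite V] : Finite R.Face :=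
  inferInstanceAs (Finite (Quotient _ ⊕ {v : V // ∀ w, ¬ G.Adj v w}))

theorem faceNext_fst (d : G.Dart) : (R.faceNext d).fst = d.snd := R.rot_fst d.symm

theorem faceNext_ne (d : G.Dart) : R.faceNext d ≠ d := fun h =>
  d.fst_ne_snd (by rw [← R.faceNext_fst d, h])

theorem faceNext_symm (d : G.Dart) : R.faceNext d.symm = R.rot d :=
  congrArg R.rot d.symm_symm

theorem faceOf_eq_iff {d d' : G.Dart} : R.faceOf d = R.faceOf d' ↔ R.faceNext.SameCycle d d' :=
  Sum.inl_injective.eq_iff.trans Quotient.eq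

theorem faceOf_faceNext (d : G.Dart) : R.faceOf (R.faceNext d) = R.faceOf d :=
  (R.faceOf_eq_iff.2 (Equiv.Perm.sameCycle_apply_right.2 (Equiv.Perm.SameCycle.refl _ _))).symm

theorem faceOf_rot (d : G.Dart) : R.faceOf (R.rot d) = R.faceOf d.symm := by
  rw [← faceNext_symm, faceOf_faceNext]

theorem apply_eq_of_fst_eq {β : Type*} {t : G.Dart → β} (hrot : ∀ d, t (R.rot d) = t d)
    {d d' : G.Dart} (h : d.fst = d'.fst) : t d = t d' :=
  apply_eq_of_sameCycle hrot (R.rot_sameCycle d d' h)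

theorem apply_eq_of_invariant (hG : G.Connected) {β : Type*} {t : G.Dart → β}
    (hrot : ∀ d, t (R.rot d) = t d) (hsymm : ∀ d, t d.symm = t d) (d d' : G.Dart) :
    t d = t d' := by
  have along_walk {u v : V} (w : G.Walk u v) :
      ∀ d d' : G.Dart, d.fst = u → d'.fst = v → t d = t d' := by
    induction w with
    | nil => exact fun d d' hd hd' => R.apply_eq_of_fst_eq hrot (hd.trans hd'.symm)
    | cons h _ ih =>
      intro d d' hd hd'
      rw [R.apply_eq_of_fst_eq hrot (d' := ⟨(_, _), h⟩) hd, ← hsymm]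
      exact ih _ _ rfl hd'
  exact along_walk (hG.preconnected d.fst d'.fst).some d d' rfl rfl

theorem boundaryFrom_eq_map_range (d : G.Dart) :
    R.boundaryFrom d =
      (List.range (Function.minimalPeriod R.faceNext d)).map fun n => R.faceNext^[n] d :=
  (List.range_map_iterate _ _ _).symm

theorem mem_boundaryFrom [Finite G.Dart] {d x : G.Dart} :
    x ∈ R.boundaryFrom d ↔ R.faceOf x = R.faceOf d := by
  have hd : d ∈ Function.periodicPts R.faceNext := R.faceNext.injective.mem_periodicPts d
  rw [boundaryFrom_eq_map_range, ← Cycle.mem_coe_iff]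
  refine (Function.mem_periodicOrbit_iff hd).trans ?_
  rw [eq_comm (a := R.faceOf x), faceOf_eq_iff]
  constructor
  · rintro ⟨n, rfl⟩
    exact ⟨n, by rw [zpow_natCast, Equiv.Perm.iterate_eq_pow]⟩
  · intro h
    obtain ⟨n, hn⟩ := h.exists_nat_pow_eq
    exact ⟨n, by rw [Equiv.Perm.iterate_eq_pow, hn]⟩

theorem nodup_boundaryFrom (d : G.Dart) : (R.boundaryFrom d).Nodup := by
  rw [boundaryFrom_eq_map_range, ← Cycle.nodup_coe_iff]
  exact Function.nodup_periodicOrbit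

theorem sides_faceOf [Finite G.Dart] (d : G.Dart) :
    R.sides (R.faceOf d) = Function.minimalPeriod R.faceNext d := by
  classical
  simp only [sides, ← R.mem_boundaryFrom]
  rw [Nat.card_congr ((R.nodup_boundaryFrom d).getEquiv _).symm, Nat.card_fin, boundaryFrom,
    List.length_iterate]

theorem sum_boundaryFrom_faceNext [Finite G.Dart] {M : Type*} [AddCommMonoid M] (g : G.Dart → M)
    (d : G.Dart) :
    ((R.boundaryFrom d).map fun x => g (R.faceNext x)).sum = ((R.boundaryFrom d).map g).sum := by
  classical
  have hl := R.nodup_boundaryFrom d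
  rw [← List.sum_toFinset _ hl, ← List.sum_toFinset _ hl]
  refine Finset.sum_equiv R.faceNext (fun x => ?_) fun _ _ => rfl
  rw [List.mem_toFinset, List.mem_toFinset, mem_boundaryFrom, mem_boundaryFrom, faceOf_faceNext]

theorem exists_walk_darts_eq_iterate (n : ℕ) (d : G.Dart) :
    ∃ w : G.Walk d.fst (R.faceNext^[n] d).fst, w.darts = List.iterate R.faceNext d n := by
  induction n generalizing d with
  | zero => exact ⟨SimpleGraph.Walk.nil, rfl⟩
  | succ n ih =>
    obtain ⟨w, hw⟩ := ih (R.faceNext d)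
    have hd : (⟨(d.fst, (R.faceNext d).fst), R.faceNext_fst d ▸ d.adj⟩ : G.Dart) = d :=
      SimpleGraph.Dart.ext _ _ (Prod.ext rfl (R.faceNext_fst d))
    exact ⟨.cons (R.faceNext_fst d ▸ d.adj) w,
      (SimpleGraph.Walk.darts_cons _ w).trans (congrArg₂ List.cons hd hw)⟩

/-- The face cycle of the face whose boundary walk runs through `d`, read from `d`. -/
noncomputable def faceCycle (d : G.Dart) : EVGroup.cycleGroup G :=
  ⟨EVGroup.loopElement G (R.boundaryFrom d), by
    obtain ⟨w, hw⟩ := R.exists_walk_darts_eq_iterate (Function.minimalPeriod R.faceNext d) d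
    refine Subgroup.subset_closure
      ⟨d.fst, w.copy rfl (by rw [Function.iterate_minimalPeriod]), ?_⟩
    rw [SimpleGraph.Walk.darts_copy, hw, boundaryFrom]⟩

/-! ### The cycle space of a plane graph -/

/-- The edges, modulo two, that bound a set of faces given by its indicator function. -/
noncomputable def faceBdry : (R.Face → ZMod 2) →ₗ[ZMod 2] (G.edgeSet → ZMod 2) where
  toFun s e := s (R.faceOf (edgeDart e)) + s (R.faceOf (edgeDart e).symm)
  map_add' _ _ := funext fun _ => add_add_add_comm _ _ _ _
  map_smul' _ _ := funext fun _ => (mul_add _ _ _).symm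

theorem faceBdry_dartEdge (s : R.Face → ZMod 2) (d : G.Dart) :
    R.faceBdry s (dartEdge d) = s (R.faceOf d) + s (R.faceOf d.symm) := by
  change s _ + s _ = _
  obtain h | h := edgeDart_dartEdge d <;> rw [h]
  rw [SimpleGraph.Dart.symm_symm, add_comm]

theorem faceBdry_const (a : ZMod 2) : R.faceBdry (fun _ => a) = 0 :=
  funext fun _ => ZModModule.add_self a

theorem apply_faceOf_eq_of_faceBdry_eq_zero (hG : G.Connected) {s : R.Face → ZMod 2}
    (h : R.faceBdry s = 0) (d d' : G.Dart) : s (R.faceOf d) = s (R.faceOf d') := by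
  have hsymm (d : G.Dart) : s (R.faceOf d.symm) = s (R.faceOf d) := by
    have hd := R.faceBdry_dartEdge s d
    rw [h, Pi.zero_apply] at hd
    exact (CharTwo.add_eq_zero.1 hd.symm).symm
  exact R.apply_eq_of_invariant hG (t := fun d => s (R.faceOf d))
    (fun d => by rw [faceOf_rot, hsymm]) hsymm d d'

open scoped Classical in
theorem cycleClass_faceCycle [Finite G.Dart] (d : G.Dart) :
    cycleClass G (.ofMul (R.faceCycle d)) = R.faceBdry (Pi.single (R.faceOf d) 1) := by
  rw [cycleClass_ofMul, faceCycle, map_loopElement edgeClass_phase]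
  simp only [edgeClass_edge]
  funext e
  obtain ⟨x, rfl⟩ := dartEdge_surjective e
  rw [← List.sum_toFinset _ (R.nodup_boundaryFrom d), Finset.sum_apply, faceBdry_dartEdge]
  simp only [dartVec_dartEdge, Finset.sum_add_distrib, Finset.sum_ite_eq, List.mem_toFinset,
    mem_boundaryFrom, Pi.single_apply]

end RotationSystem

section VertexBoundary

variable {V : Type*} {G : SimpleGraph V}

open scoped Classical in
/-- The vertices, modulo two, at which a set of edges has odd degree. -/
noncomputable def vertexBdry (G : SimpleGraph V) [Finite G.edgeSet] :
    (G.edgeSet → ZMod 2) →ₗ[ZMod 2] (V → ZMod 2) :=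
  (Pi.basisFun (ZMod 2) G.edgeSet).constr ℕ fun e =>
    Pi.single (edgeDart e).fst 1 + Pi.single (edgeDart e).snd 1

open scoped Classical in
theorem vertexBdry_dartVec [Finite G.edgeSet] (d : G.Dart) :
    vertexBdry G (dartVec d) = Pi.single d.fst 1 + Pi.single d.snd 1 := by
  rw [dartVec, ← Pi.basisFun_apply, vertexBdry, Module.Basis.constr_basis]
  obtain h | h := edgeDart_dartEdge d <;> rw [h]
  exact add_comm _ _

open scoped Classical in
theorem vertexBdry_walk [Finite G.edgeSet] {u v : V} (w : G.Walk u v) :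
    vertexBdry G (w.darts.map dartVec).sum = Pi.single u 1 + Pi.single v 1 := by
  induction w with
  | nil => rw [ZModModule.add_self]; exact map_zero _
  | cons h _ ih =>
    rw [SimpleGraph.Walk.darts_cons, List.map_cons, List.sum_cons, map_add, ih,
      vertexBdry_dartVec, ZModModule.add_add_add_cancel]

theorem vertexBdry_edgeClass [Finite G.edgeSet] {c : EVGroup G} (hc : c ∈ EVGroup.cycleGroup G) :
    vertexBdry G (edgeClass G (.ofMul c)) = 0 := by
  induction hc using Subgroup.closure_induction with
  | mem x hx =>
    obtain ⟨u, w, rfl⟩ := hx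
    simp only [map_loopElement edgeClass_phase, edgeClass_edge]
    rw [vertexBdry_walk, ZModModule.add_self]
  | one => rw [ofMul_one, map_zero, map_zero]
  | mul x y _ _ hx hy => rw [ofMul_mul, map_add, map_add, hx, hy, add_zero]
  | inv x _ hx => rw [ofMul_inv, map_neg, map_neg, hx, neg_zero]

theorem card_le_finrank_range_vertexBdry_add_one [Finite V] (hG : G.Connected) :
    Nat.card V ≤ Module.finrank (ZMod 2) ((vertexBdry G).range) + 1 := by
  classical
  obtain ⟨v₀⟩ := hG.nonempty
  let base := Submodule.span (ZMod 2) {(Pi.single v₀ 1 : V → ZMod 2)}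
  have sup_eq_top : (vertexBdry G).range ⊔ base = ⊤ := by
    rw [← top_le_iff, ← (Pi.basisFun (ZMod 2) V).span_eq, Submodule.span_le]
    rintro _ ⟨v, rfl⟩
    obtain ⟨w⟩ := hG.preconnected v v₀
    have hv : Pi.single v 1 = vertexBdry G (w.darts.map dartVec).sum + Pi.single v₀ 1 := by
      rw [vertexBdry_walk, add_assoc, ZModModule.add_self, add_zero]
    rw [SetLike.mem_coe, Pi.basisFun_apply, hv]
    exact add_mem (Submodule.mem_sup_left (LinearMap.mem_range_self _ _))
      (Submodule.mem_sup_right (Submodule.mem_span_singleton_self _))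
  have base_le : Module.finrank (ZMod 2) base ≤ 1 := by
    simpa using finrank_span_le_card (R := ZMod 2) {(Pi.single v₀ 1 : V → ZMod 2)}
  calc Nat.card V = Module.finrank (ZMod 2) (V → ZMod 2) :=
        (Module.finrank_eq_nat_card_basis (Pi.basisFun (ZMod 2) V)).symm
    _ = Module.finrank (ZMod 2) ↥((vertexBdry G).range ⊔ base) := by
        rw [sup_eq_top, finrank_top]
    _ ≤ _ := (Submodule.finrank_add_le_finrank_add_finrank _ _).trans (by gcongr)

end VertexBoundary

namespace RotationSystem

variable {V : Type*} {G : SimpleGraph V} (R : RotationSystem G)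

theorem exists_faceOf_eq_of_nontrivial [Nontrivial V] (hG : G.Connected) (f : R.Face) :
    ∃ d, R.faceOf d = f := by
  obtain ⟨⟨d⟩⟩ | ⟨v, hv⟩ := f
  · exact ⟨d, rfl⟩
  · obtain ⟨w, hw⟩ := hG.preconnected.exists_adj_of_nontrivial v
    exact (hv w hw).elim

theorem subsingleton_face [Subsingleton V] : Subsingleton R.Face := by
  have no_dart (d : G.Dart) : False := d.fst_ne_snd (Subsingleton.elim _ _)
  constructor
  rintro (⟨⟨d⟩⟩ | ⟨v, hv⟩) (⟨⟨d'⟩⟩ | ⟨v', hv'⟩)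
  · exact (no_dart d).elim
  · exact (no_dart d).elim
  · exact (no_dart d').elim
  · exact congrArg Sum.inr (Subsingleton.elim _ _)

theorem eq_of_faceBdry_eq_zero (hG : G.Connected) {s : R.Face → ZMod 2} (h : R.faceBdry s = 0)
    (f f' : R.Face) : s f = s f' := by
  obtain hV | hV := subsingleton_or_nontrivial V
  · have := R.subsingleton_face
    rw [Subsingleton.elim f f']
  · obtain ⟨d, rfl⟩ := R.exists_faceOf_eq_of_nontrivial hG f
    obtain ⟨d', rfl⟩ := R.exists_faceOf_eq_of_nontrivial hG f'
    exact R.apply_faceOf_eq_of_faceBdry_eq_zero hG h d d'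

theorem finrank_ker_faceBdry_le_one (hG : G.Connected) :
    Module.finrank (ZMod 2) (R.faceBdry.ker) ≤ 1 := by
  refine finrank_le_one ⟨fun _ => 1, R.faceBdry_const 1⟩ fun s => ?_
  obtain h | ⟨⟨f⟩⟩ := isEmpty_or_nonempty R.Face
  · exact ⟨0, Subtype.ext (funext h.elim)⟩
  · exact ⟨s.1 f, Subtype.ext <| funext fun f' =>
      (mul_one _).trans (R.eq_of_faceBdry_eq_zero hG s.2 f f')⟩

open scoped Classical in
theorem linearIndepOn_faceBdry_single (hG : G.Connected) (f₀ : R.Face) :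
    LinearIndepOn (ZMod 2) (fun f => R.faceBdry (Pi.single f 1)) {f | f ≠ f₀} := by
  have indep := (Pi.linearIndependent_single_one R.Face (ZMod 2)).linearIndepOn {f | f ≠ f₀}
  refine indep.map (f := R.faceBdry) ?_
  rw [Submodule.disjoint_def]
  intro s hs hs₀
  have apply_base : s f₀ = 0 := by
    refine Submodule.span_le (p := (LinearMap.proj (R := ZMod 2) f₀).ker).2 ?_ hs
    rintro _ ⟨⟨f, hf⟩, rfl⟩
    exact Pi.single_eq_of_ne' hf 1
  exact funext fun f => (R.eq_of_faceBdry_eq_zero hG hs₀ f f₀).trans apply_base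

theorem range_faceBdry_le_ker_vertexBdry [Finite V] :
    R.faceBdry.range ≤ (vertexBdry G).ker := by
  classical
  rw [LinearMap.range_le_ker_iff]
  refine (Pi.basisFun (ZMod 2) R.Face).ext fun f => ?_
  rw [Pi.basisFun_apply, LinearMap.comp_apply, LinearMap.zero_apply]
  by_cases hf : ∃ d, R.faceOf d = f
  · obtain ⟨d, rfl⟩ := hf
    rw [← R.cycleClass_faceCycle, cycleClass_ofMul]
    exact vertexBdry_edgeClass (R.faceCycle d).2
  · have single_faceOf (d : G.Dart) : (Pi.single f 1 : R.Face → ZMod 2) (R.faceOf d) = 0 :=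
      Pi.single_eq_of_ne (fun h => hf ⟨d, h⟩) 1
    suffices R.faceBdry (Pi.single f 1) = 0 by rw [this, map_zero]
    funext e
    obtain ⟨d, rfl⟩ := dartEdge_surjective e
    rw [faceBdry_dartEdge, single_faceOf, single_faceOf, add_zero, Pi.zero_apply]

end RotationSystem

namespace PlaneEmbedding

variable {V : Type*} [Finite V] {G : SimpleGraph V} (E : PlaneEmbedding G)

theorem range_faceBdry (hG : G.Connected) : E.faceBdry.range = (vertexBdry G).ker := by
  refine Submodule.eq_of_le_of_finrank_le E.range_faceBdry_le_ker_vertexBdry ?_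
  have rank_faces := E.faceBdry.finrank_range_add_finrank_ker
  have rank_edges := (vertexBdry G).finrank_range_add_finrank_ker
  rw [Module.finrank_eq_nat_card_basis (Pi.basisFun (ZMod 2) _)] at rank_faces rank_edges
  have ker_le := E.finrank_ker_faceBdry_le_one hG
  have range_ge := card_le_finrank_range_vertexBdry_add_one hG
  have euler := E.euler
  lia

theorem exists_faceBdry_eq_edgeClass (hG : G.Connected) {c : EVGroup G}
    (hc : c ∈ EVGroup.cycleGroup G) :
    ∃ s : E.Face → ZMod 2, s E.outer = 0 ∧ E.faceBdry s = edgeClass G (.ofMul c) := by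
  obtain ⟨s, hs⟩ : edgeClass G (.ofMul c) ∈ E.faceBdry.range := by
    rw [E.range_faceBdry hG]
    exact vertexBdry_edgeClass hc
  refine ⟨s + fun _ => s E.outer, ZModModule.add_self _, ?_⟩
  rw [map_add, E.faceBdry_const, add_zero, hs]

end PlaneEmbedding

/-! ### Turns of the face boundaries that share an auxiliary qubit -/

/-- The Pauli operators up to phase that a Weight 3 planar encoding with simply bounded faces
assigns to the edges, without reference to the encoding. -/
structure IsWeightThreeSystem {V A : Type*} [Fintype V] [Fintype A] {G : SimpleGraph V}
    (R : RotationSystem G) (loc : A → R.Face) (u : G.edgeSet → V ⊕ A → PauliVec) : Prop where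
  loc_injective : Function.Injective loc
  isSimpleFace_loc : ∀ a, R.IsSimpleFace (loc a)
  fst_snd_eq_one : ∀ d, (u (dartEdge d) (.inl d.snd)).1 = 1
  eq_zero_of_ne : ∀ d v, v ≠ d.fst → v ≠ d.snd → u (dartEdge d) (.inl v) = 0
  adjacent_loc : ∀ d a, u (dartEdge d) (.inr a) ≠ 0 → R.Adjacent d (loc a)
  aux_unique : ∀ e a b, u e (.inr a) ≠ 0 → u e (.inr b) ≠ 0 → a = b
  sympForm_eq_zero : ∀ d d', d.fst ≠ d'.fst → d.fst ≠ d'.snd → d.snd ≠ d'.fst → d.snd ≠ d'.snd →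
    sympForm (u (dartEdge d)) (u (dartEdge d')) = 0
  sympForm_eq_one : ∀ d d', d.snd = d'.fst → d.fst ≠ d'.snd →
    sympForm (u (dartEdge d)) (u (dartEdge d')) = 1

theorem ne_dart_symm_iff {V : Type*} {G : SimpleGraph V} {d d' : G.Dart} (hd : d.snd = d'.fst) :
    d' ≠ d.symm ↔ d.fst ≠ d'.snd :=
  not_congr ⟨fun h => by rw [h]; rfl, fun h => SimpleGraph.Dart.ext _ _ (Prod.ext hd.symm h.symm)⟩

namespace RotationSystem

variable {V A : Type*} {G : SimpleGraph V} (R : RotationSystem G) (loc : A → R.Face)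
  (u : G.edgeSet → V ⊕ A → PauliVec)

/-- The turn from `d` to the next directed edge around the same face is paired if the auxiliary
qubit of that face carries anticommuting Pauli operators of the two edges. -/
def IsPairedTurn (d : G.Dart) : Prop :=
  ∃ a, loc a = R.faceOf d ∧
    (u (dartEdge d) (.inr a)).symp (u (dartEdge (R.faceNext d)) (.inr a)) = 1

variable {R loc u}

theorem IsPairedTurn.faceNext_ne_symm {d : G.Dart} (hd : R.IsPairedTurn loc u d) :
    R.faceNext d ≠ d.symm := by
  intro hsymm
  obtain ⟨a, -, ha⟩ := hd
  rw [hsymm, dartEdge_symm, PauliVec.symp_self] at ha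
  exact zero_ne_one ha

theorem IsPairedTurn.faceNext_faceNext_ne {d : G.Dart} (hd : R.IsPairedTurn loc u d) :
    R.faceNext (R.faceNext d) ≠ d := fun hback =>
  (ne_dart_symm_iff (R.faceNext_fst d).symm).1 hd.faceNext_ne_symm
    (by rw [← R.faceNext_fst, hback])

theorem IsPairedTurn.exists_aux_ne_zero {d : G.Dart} (hd : R.IsPairedTurn loc u d) :
    ∃ a, loc a = R.faceOf d ∧ u (dartEdge d) (.inr a) ≠ 0 ∧
      u (dartEdge (R.faceNext d)) (.inr a) ≠ 0 := by
  obtain ⟨a, ha, hone⟩ := hd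
  exact ⟨a, ha, PauliVec.ne_zero_of_symp_ne_zero (hone ▸ one_ne_zero)⟩

end RotationSystem

namespace IsWeightThreeSystem

variable {V A : Type*} [Fintype V] [Fintype A] {G : SimpleGraph V} {R : RotationSystem G}
  {loc : A → R.Face} {u : G.edgeSet → V ⊕ A → PauliVec} (h : IsWeightThreeSystem R loc u)

include h

theorem fst_fst_eq_one (d : G.Dart) : (u (dartEdge d) (.inl d.fst)).1 = 1 := by
  rw [← dartEdge_symm]
  exact h.fst_snd_eq_one d.symm

theorem inl_eq_zero_or_fst_eq_one (e : G.edgeSet) (v : V) :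
    u e (.inl v) = 0 ∨ (u e (.inl v)).1 = 1 := by
  obtain ⟨d, rfl⟩ := dartEdge_surjective e
  by_cases hfst : v = d.fst
  · exact .inr (hfst ▸ h.fst_fst_eq_one d)
  by_cases hsnd : v = d.snd
  · exact .inr (hsnd ▸ h.fst_snd_eq_one d)
  · exact .inl (h.eq_zero_of_ne d v hfst hsnd)

theorem exists_snd_eq_of_inl_ne_zero {e : G.edgeSet} {v : V} (hv : u e (.inl v) ≠ 0) :
    ∃ d : G.Dart, d.snd = v ∧ dartEdge d = e := by
  obtain ⟨d, rfl⟩ := dartEdge_surjective e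
  by_contra! hd
  exact hv (h.eq_zero_of_ne d v (fun hv' => hd d.symm hv'.symm (dartEdge_symm d))
    fun hv' => hd d hv'.symm rfl)

theorem eq_of_faceOf_eq_loc {a : A} {d d' : G.Dart} (hd : R.faceOf d = loc a)
    (hd' : R.faceOf d' = loc a) (hfst : d.fst = d'.fst) : d = d' :=
  h.isSimpleFace_loc a d d' hd hd' hfst

theorem eq_of_faceOf_eq_loc_of_snd {a : A} {d d' : G.Dart} (hd : R.faceOf d = loc a)
    (hd' : R.faceOf d' = loc a) (hsnd : d.snd = d'.snd) : d = d' :=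
  R.faceNext.injective <| h.isSimpleFace_loc a _ _ ((R.faceOf_faceNext d).trans hd)
    ((R.faceOf_faceNext d').trans hd') (by rw [R.faceNext_fst, R.faceNext_fst, hsnd])

theorem faceNext_eq_of_faceOf_eq_loc {a : A} {d d' : G.Dart} (hd : R.faceOf d = loc a)
    (hd' : R.faceOf d' = loc a) (hsnd : d.snd = d'.fst) : R.faceNext d = d' :=
  h.isSimpleFace_loc a _ _ ((R.faceOf_faceNext d).trans hd) hd' ((R.faceNext_fst d).trans hsnd)

theorem sympForm_eq_add {d d' : G.Dart} (hd : d.snd = d'.fst) (hne : d' ≠ d.symm) :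
    sympForm (u (dartEdge d)) (u (dartEdge d')) =
      (u (dartEdge d) (.inl d.snd)).symp (u (dartEdge d') (.inl d.snd)) +
        ∑ a, (u (dartEdge d) (.inr a)).symp (u (dartEdge d') (.inr a)) := by
  rw [sympForm, Fintype.sum_sum_type]
  congr 1
  refine Finset.sum_eq_single _ (fun v _ hv => ?_) fun hv => (hv (Finset.mem_univ _)).elim
  by_cases hfst : v = d.fst
  · rw [h.eq_zero_of_ne d' v (hd ▸ hv) (hfst ▸ (ne_dart_symm_iff hd).1 hne), PauliVec.symp_zero]
  · rw [h.eq_zero_of_ne d v hfst hv, PauliVec.zero_symp]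

theorem sum_aux_symp {d : G.Dart} {a : A} (ha : u (dartEdge d) (.inr a) ≠ 0) (e : G.edgeSet) :
    ∑ b, (u (dartEdge d) (.inr b)).symp (u e (.inr b)) =
      (u (dartEdge d) (.inr a)).symp (u e (.inr a)) := by
  refine Finset.sum_eq_single a (fun b _ hb => ?_) fun ha => (ha (Finset.mem_univ a)).elim
  by_contra hne
  exact hb (h.aux_unique _ b a (PauliVec.ne_zero_of_symp_ne_zero hne).1 ha)

theorem inl_eq_of_isPairedTurn {d : G.Dart} (hd : R.IsPairedTurn loc u d) :
    u (dartEdge d) (.inl d.snd) = u (dartEdge (R.faceNext d)) (.inl d.snd) := by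
  have hne := hd.faceNext_ne_symm
  obtain ⟨a, -, ha⟩ := hd
  have hsnd := (R.faceNext_fst d).symm
  have hone := h.sympForm_eq_one _ _ hsnd ((ne_dart_symm_iff hsnd).1 hne)
  have hda := (PauliVec.ne_zero_of_symp_ne_zero (ha ▸ one_ne_zero)).1
  rw [h.sympForm_eq_add hsnd hne, h.sum_aux_symp hda, ha, add_eq_right] at hone
  refine PauliVec.eq_of_symp_eq_zero_of_fst (h.fst_snd_eq_one d) ?_ hone
  rw [hsnd]
  exact h.fst_fst_eq_one _

theorem isPairedTurn_or_of_inl_eq {d d' : G.Dart} (hne : d ≠ d') (hsnd : d.snd = d'.snd)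
    (hinl : u (dartEdge d) (.inl d.snd) = u (dartEdge d') (.inl d.snd)) :
    (R.IsPairedTurn loc u d ∧ R.faceNext d = d'.symm) ∨
      (R.IsPairedTurn loc u d' ∧ R.faceNext d' = d.symm) := by
  have hne_symm : d'.symm ≠ d.symm := SimpleGraph.Dart.symm_involutive.injective.ne hne.symm
  have hone := h.sympForm_eq_one d d'.symm hsnd ((ne_dart_symm_iff hsnd).1 hne_symm)
  rw [h.sympForm_eq_add hsnd hne_symm, dartEdge_symm, ← hinl, PauliVec.symp_self, zero_add] at hone
  obtain ⟨a, -, ha⟩ := Finset.exists_ne_zero_of_sum_ne_zero (hone ▸ one_ne_zero)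
  obtain ⟨hda, hda'⟩ := PauliVec.ne_zero_of_symp_ne_zero ha
  have ha_one : (u (dartEdge d) (.inr a)).symp (u (dartEdge d') (.inr a)) = 1 :=
    (h.sum_aux_symp hda _).symm.trans hone
  rcases h.adjacent_loc d a hda with hf | hf <;> rcases h.adjacent_loc d' a hda' with hf' | hf'
  · exact (hne (h.eq_of_faceOf_eq_loc_of_snd hf hf' hsnd)).elim
  · have hnext := h.faceNext_eq_of_faceOf_eq_loc hf hf' hsnd
    exact .inl ⟨⟨a, hf.symm, by rw [hnext, dartEdge_symm, ha_one]⟩, hnext⟩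
  · have hnext := h.faceNext_eq_of_faceOf_eq_loc hf' hf hsnd.symm
    exact .inr ⟨⟨a, hf'.symm, by rw [hnext, dartEdge_symm, PauliVec.symp_comm, ha_one]⟩, hnext⟩
  · exact (hne_symm (h.eq_of_faceOf_eq_loc hf' hf hsnd.symm)).elim

theorem not_isPairedTurn_symm_faceNext {d : G.Dart} (hd : R.IsPairedTurn loc u d) :
    ¬ R.IsPairedTurn loc u (R.faceNext d).symm := by
  intro hd'
  obtain ⟨a, hloc, -, ha⟩ := hd.exists_aux_ne_zero
  obtain ⟨b, hloc', hb, -⟩ := hd'.exists_aux_ne_zero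
  obtain rfl := h.aux_unique _ _ _ (dartEdge_symm (R.faceNext d) ▸ hb) ha
  have hback := h.eq_of_faceOf_eq_loc_of_snd hloc.symm hloc'.symm (R.faceNext_fst d).symm
  exact hd.faceNext_ne_symm (SimpleGraph.Dart.symm_involutive.eq_iff.1 hback.symm)

theorem eq_or_isPairedTurn_of_inl_eq {e : G.edgeSet} {d : G.Dart}
    (he : u e (.inl d.snd) = u (dartEdge d) (.inl d.snd)) :
    e = dartEdge d ∨ (R.IsPairedTurn loc u d ∧ e = dartEdge (R.faceNext d)) ∨
      ∃ d', R.IsPairedTurn loc u d' ∧ R.faceNext d' = d.symm := by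
  have inl_ne_zero : u e (.inl d.snd) ≠ 0 := fun h0 =>
    zero_ne_one (α := ZMod 2) (by rw [← h.fst_snd_eq_one d, ← he, h0, Prod.fst_zero])
  obtain ⟨x, hx, rfl⟩ := h.exists_snd_eq_of_inl_ne_zero inl_ne_zero
  obtain rfl | hxd := eq_or_ne d x
  · exact .inl rfl
  obtain ⟨hd, hnext⟩ | hx' := h.isPairedTurn_or_of_inl_eq hxd hx.symm he.symm
  · exact .inr (.inl ⟨hd, by rw [hnext, dartEdge_symm]⟩)
  · exact .inr (.inr ⟨x, hx'⟩)

section VertexEquations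

variable [Fintype G.edgeSet] {y : G.edgeSet → ZMod 2} (hy : ∑ e, y e • u e = 0)

include hy

theorem sum_eq_zero_of_inl_eq {a : PauliVec} (ha : a.1 = 1) (v : V) :
    ∑ e with u e (.inl v) = a, y e = 0 := by
  let φ : PauliVec →ₗ[ZMod 2] ZMod 2 :=
    .fst _ _ _ + (a.1 • .snd _ _ _ + a.2 • .fst _ _ _)
  have hφ (e : G.edgeSet) : φ (u e (.inl v)) = if u e (.inl v) = a then 1 else 0 :=
    PauliVec.fst_add_symp_eq_ite ha (h.inl_eq_zero_or_fst_eq_one e v)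
  have hv := congrArg φ (congrFun hy (.inl v))
  simpa only [Finset.sum_apply, Pi.smul_apply, Pi.zero_apply, map_sum, map_smul, map_zero, hφ,
    smul_eq_mul, mul_ite, mul_one, mul_zero, ← Finset.sum_filter] using hv

theorem add_eq_zero_of_isPairedTurn {d : G.Dart} (hd : R.IsPairedTurn loc u d) :
    y (dartEdge d) + y (dartEdge (R.faceNext d)) = 0 := by
  classical
  have edge_ne : dartEdge d ≠ dartEdge (R.faceNext d) := fun he =>
    (dartEdge_eq_iff.1 he.symm).elim (R.faceNext_ne d) hd.faceNext_ne_symm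
  have hsum := h.sum_eq_zero_of_inl_eq hy (h.fst_snd_eq_one d) d.snd
  rw [← Finset.sum_pair edge_ne, ← hsum]
  congr 1
  ext e
  simp only [Finset.mem_insert, Finset.mem_singleton, Finset.mem_filter_univ]
  constructor
  · rintro (rfl | rfl)
    exacts [rfl, (h.inl_eq_of_isPairedTurn hd).symm]
  · intro he
    obtain rfl | ⟨-, rfl⟩ | ⟨d', hd', hnext⟩ := h.eq_or_isPairedTurn_of_inl_eq he
    · exact .inl rfl
    · exact .inr rfl
    · exact (h.not_isPairedTurn_symm_faceNext hd' (by rwa [hnext, d.symm_symm])).elim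

theorem eq_zero_of_not_isPairedTurn {d d' : G.Dart} (hd' : R.faceNext d' = d.symm)
    (hpaired : ¬ R.IsPairedTurn loc u d) (hpaired' : ¬ R.IsPairedTurn loc u d') :
    y (dartEdge d) = 0 := by
  classical
  have hsum := h.sum_eq_zero_of_inl_eq hy (h.fst_snd_eq_one d) d.snd
  rw [← hsum, ← Finset.sum_singleton y]
  congr 1
  ext e
  simp only [Finset.mem_singleton, Finset.mem_filter_univ]
  constructor
  · rintro rfl
    rfl
  · intro he
    obtain rfl | ⟨hd, -⟩ | ⟨x, hx, hnext⟩ := h.eq_or_isPairedTurn_of_inl_eq he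
    · rfl
    · exact (hpaired hd).elim
    · exact (hpaired' (R.faceNext.injective (hd'.trans hnext.symm) ▸ hx)).elim

end VertexEquations

end IsWeightThreeSystem

namespace RotationSystem

variable {V A : Type*} {G : SimpleGraph V} (R : RotationSystem G) (loc : A → R.Face)
  (u : G.edgeSet → V ⊕ A → PauliVec)

open scoped Classical in
/-- The value on a turn of a function of the faces: that of the face of the turn, except that at a
paired turn it is that of the face across the edge along which the turn starts. -/
noncomputable def turnValue (s : R.Face → ZMod 2) (d : G.Dart) : ZMod 2 :=
  if R.IsPairedTurn loc u d then s (R.faceOf d.symm) else s (R.faceOf d)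

variable {R loc u} {s : R.Face → ZMod 2} {d : G.Dart}

theorem turnValue_of_isPairedTurn (hd : R.IsPairedTurn loc u d) :
    R.turnValue loc u s d = s (R.faceOf d.symm) := if_pos hd

theorem turnValue_of_not_isPairedTurn (hd : ¬ R.IsPairedTurn loc u d) :
    R.turnValue loc u s d = s (R.faceOf d) := if_neg hd

end RotationSystem

namespace IsWeightThreeSystem

open RotationSystem

variable {V A : Type*} [Fintype V] [Fintype A] {G : SimpleGraph V} {R : RotationSystem G}
  {loc : A → R.Face} {u : G.edgeSet → V ⊕ A → PauliVec} (h : IsWeightThreeSystem R loc u)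
  [Fintype G.edgeSet] {s : R.Face → ZMod 2} (hs : ∑ e, R.faceBdry s e • u e = 0)

include h hs

theorem apply_faceOf_symm_eq_of_isPairedTurn {d : G.Dart} (hd : R.IsPairedTurn loc u d) :
    s (R.faceOf d.symm) = s (R.faceOf (R.faceNext d).symm) := by
  have hadd := h.add_eq_zero_of_isPairedTurn hs hd
  rw [R.faceBdry_dartEdge, R.faceBdry_dartEdge, R.faceOf_faceNext, add_comm (s (R.faceOf d)),
    ZModModule.add_add_add_cancel] at hadd
  exact CharTwo.add_eq_zero.1 hadd

theorem apply_faceOf_symm_eq_of_not_isPairedTurn {d d' : G.Dart} (hd' : R.faceNext d' = d.symm)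
    (hpaired : ¬ R.IsPairedTurn loc u d) (hpaired' : ¬ R.IsPairedTurn loc u d') :
    s (R.faceOf d.symm) = s (R.faceOf d) := by
  have hadd := h.eq_zero_of_not_isPairedTurn hs hd' hpaired hpaired'
  rw [R.faceBdry_dartEdge] at hadd
  exact (CharTwo.add_eq_zero.1 hadd).symm

theorem turnValue_symm_faceNext (d : G.Dart) :
    R.turnValue loc u s (R.faceNext d).symm = R.turnValue loc u s d := by
  by_cases hd : R.IsPairedTurn loc u d
  · rw [turnValue_of_not_isPairedTurn (h.not_isPairedTurn_symm_faceNext hd),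
      turnValue_of_isPairedTurn hd, h.apply_faceOf_symm_eq_of_isPairedTurn hs hd]
  rw [turnValue_of_not_isPairedTurn hd]
  by_cases hd' : R.IsPairedTurn loc u (R.faceNext d).symm
  · rw [turnValue_of_isPairedTurn hd', SimpleGraph.Dart.symm_symm, faceOf_faceNext]
  · rw [turnValue_of_not_isPairedTurn hd', ← R.faceOf_faceNext d,
      ← h.apply_faceOf_symm_eq_of_not_isPairedTurn hs (SimpleGraph.Dart.symm_symm _).symm hd' hd,
      SimpleGraph.Dart.symm_symm]

theorem turnValue_symm (d : G.Dart) : R.turnValue loc u s d.symm = R.turnValue loc u s d := by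
  by_cases hd : R.IsPairedTurn loc u d <;> by_cases hd' : R.IsPairedTurn loc u d.symm
  · obtain ⟨a, ha, hda, -⟩ := hd.exists_aux_ne_zero
    obtain ⟨b, hb, hdb, -⟩ := hd'.exists_aux_ne_zero
    obtain rfl := h.aux_unique _ a b hda (dartEdge_symm d ▸ hdb)
    rw [turnValue_of_isPairedTurn hd, turnValue_of_isPairedTurn hd', SimpleGraph.Dart.symm_symm,
      ← ha, ← hb]
  · rw [turnValue_of_isPairedTurn hd, turnValue_of_not_isPairedTurn hd']
  · rw [turnValue_of_not_isPairedTurn hd, turnValue_of_isPairedTurn hd',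
      SimpleGraph.Dart.symm_symm]
  rw [turnValue_of_not_isPairedTurn hd, turnValue_of_not_isPairedTurn hd']
  obtain ⟨w, hw⟩ := R.faceNext.surjective d.symm
  obtain ⟨w', hw'⟩ := R.faceNext.surjective d
  by_cases hpw : R.IsPairedTurn loc u w
  · by_cases hpw' : R.IsPairedTurn loc u w'
    · obtain ⟨a, ha, -, hda⟩ := hpw.exists_aux_ne_zero
      obtain ⟨b, hb, -, hdb⟩ := hpw'.exists_aux_ne_zero
      rw [hw, dartEdge_symm] at hda
      rw [hw'] at hdb
      obtain rfl := h.aux_unique _ a b hda hdb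
      rw [← hw, ← hw', faceOf_faceNext, faceOf_faceNext, ← ha, ← hb]
    · rw [← h.apply_faceOf_symm_eq_of_not_isPairedTurn hs (hw'.trans d.symm_symm.symm) hd' hpw',
        SimpleGraph.Dart.symm_symm]
  · exact h.apply_faceOf_symm_eq_of_not_isPairedTurn hs hw hd hpw

theorem isPairedTurn_of_apply_faceOf_ne_zero (hG : G.Connected) {f₀ : R.Face}
    (hf₀ : ∀ a, loc a ≠ f₀) (hsf₀ : s f₀ = 0) {d : G.Dart} (hd : s (R.faceOf d) ≠ 0) :
    R.IsPairedTurn loc u d := by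
  by_contra hpaired
  have : Nontrivial V := ⟨d.fst, d.snd, d.fst_ne_snd⟩
  obtain ⟨d₀, rfl⟩ := R.exists_faceOf_eq_of_nontrivial hG f₀
  have hpaired₀ : ¬ R.IsPairedTurn loc u d₀ := fun ⟨a, ha, _⟩ => hf₀ a ha
  have hrot (x : G.Dart) : R.turnValue loc u s (R.rot x) = R.turnValue loc u s x := by
    rw [← faceNext_symm, ← h.turnValue_symm hs, h.turnValue_symm_faceNext hs,
      h.turnValue_symm hs]
  apply hd
  rw [← turnValue_of_not_isPairedTurn (s := s) hpaired,
    R.apply_eq_of_invariant hG hrot (h.turnValue_symm hs) d d₀,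
    turnValue_of_not_isPairedTurn hpaired₀, hsf₀]

end IsWeightThreeSystem

namespace IsWeightThreeSystem

variable {V A : Type*} [Fintype V] [Fintype A] {G : SimpleGraph V} {R : RotationSystem G}
  {loc : A → R.Face} {u : G.edgeSet → V ⊕ A → PauliVec} (h : IsWeightThreeSystem R loc u) {a : A}
  (ha : ∀ d, R.faceOf d = loc a → R.IsPairedTurn loc u d)

include h ha

theorem symp_faceNext_eq_one {d : G.Dart} (hd : R.faceOf d = loc a) :
    (u (dartEdge d) (.inr a)).symp (u (dartEdge (R.faceNext d)) (.inr a)) = 1 := by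
  obtain ⟨b, hb, hone⟩ := ha d hd
  exact h.loc_injective (hb.trans hd) ▸ hone

theorem aux_ne_zero {d : G.Dart} (hd : R.faceOf d = loc a) : u (dartEdge d) (.inr a) ≠ 0 :=
  (PauliVec.ne_zero_of_symp_ne_zero (h.symp_faceNext_eq_one ha hd ▸ one_ne_zero)).1

theorem aux_eq_of_not_consecutive {d d' : G.Dart} (hd : R.faceOf d = loc a)
    (hd' : R.faceOf d' = loc a) (hne : d ≠ d') (hnext : R.faceNext d ≠ d')
    (hnext' : R.faceNext d' ≠ d) : u (dartEdge d) (.inr a) = u (dartEdge d') (.inr a) := by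
  have fst_fst : d.fst ≠ d'.fst := fun hv => hne (h.eq_of_faceOf_eq_loc hd hd' hv)
  have fst_snd : d.fst ≠ d'.snd := fun hv =>
    hnext' (h.faceNext_eq_of_faceOf_eq_loc hd' hd hv.symm)
  have snd_fst : d.snd ≠ d'.fst := fun hv => hnext (h.faceNext_eq_of_faceOf_eq_loc hd hd' hv)
  have snd_snd : d.snd ≠ d'.snd := fun hv => hne (h.eq_of_faceOf_eq_loc_of_snd hd hd' hv)
  have hcomm := h.sympForm_eq_zero d d' fst_fst fst_snd snd_fst snd_snd
  have inl_symp (v : V) : (u (dartEdge d) (.inl v)).symp (u (dartEdge d') (.inl v)) = 0 := by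
    by_cases hv : v = d.fst ∨ v = d.snd
    · rw [h.eq_zero_of_ne d' v (by rcases hv with rfl | rfl <;> assumption)
        (by rcases hv with rfl | rfl <;> assumption), PauliVec.symp_zero]
    · rw [h.eq_zero_of_ne d v (not_or.1 hv).1 (not_or.1 hv).2, PauliVec.zero_symp]
  rw [sympForm, Fintype.sum_sum_type, Finset.sum_eq_zero fun v _ => inl_symp v, zero_add,
    h.sum_aux_symp (h.aux_ne_zero ha hd)] at hcomm
  exact PauliVec.eq_of_symp_eq_zero (h.aux_ne_zero ha hd) (h.aux_ne_zero ha hd') hcomm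

theorem minimalPeriod_eq_three_or_four {d : G.Dart} (hd : R.faceOf d = loc a) :
    Function.minimalPeriod R.faceNext d = 3 ∨ Function.minimalPeriod R.faceNext d = 4 := by
  have h₁ := R.faceNext_ne d
  have h₂ := (ha d hd).faceNext_faceNext_ne
  have hd₁ := (R.faceOf_faceNext d).trans hd
  set d₁ := R.faceNext d
  have hd₂ := (R.faceOf_faceNext d₁).trans hd₁
  set d₂ := R.faceNext d₁
  have hd₃ := (R.faceOf_faceNext d₂).trans hd₂
  have hone := h.symp_faceNext_eq_one ha hd₂
  set d₃ := R.faceNext d₂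
  by_cases h₃ : d₃ = d
  · have := Fact.mk Nat.prime_three
    exact .inl (Function.minimalPeriod_eq_prime h₃ h₁)
  by_cases h₄ : R.faceNext d₃ = d
  · have := Fact.mk Nat.prime_two
    exact .inr (Function.minimalPeriod_eq_prime_pow (p := 2) (k := 1) h₂ h₄)
  have eq₂ := h.aux_eq_of_not_consecutive ha hd hd₂ h₂.symm (R.faceNext_ne d₁).symm h₃
  have eq₃ := h.aux_eq_of_not_consecutive ha hd hd₃ (Ne.symm h₃)
    (R.faceNext.injective.ne h₂.symm) h₄
  rw [← eq₂, ← eq₃, PauliVec.symp_self] at hone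
  exact (zero_ne_one hone).elim

theorem sum_boundaryFrom_inl_eq_zero {d : G.Dart} (hd : R.faceOf d = loc a) (v : V) :
    ((R.boundaryFrom d).map fun x => u (dartEdge x) (.inl v)).sum = 0 := by
  classical
  let g (x : G.Dart) : PauliVec := if v = x.fst then u (dartEdge x) (.inl v) else 0
  have eq_add_next {x : G.Dart} (hx : x ∈ R.boundaryFrom d) :
      u (dartEdge x) (.inl v) = g x + g (R.faceNext x) := by
    have hpaired := ha x ((R.mem_boundaryFrom.1 hx).trans hd)
    by_cases hfst : v = x.fst
    · have hsnd : v ≠ (R.faceNext x).fst := by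
        rw [R.faceNext_fst, hfst]
        exact x.fst_ne_snd
      simp only [g, if_pos hfst, if_neg hsnd, add_zero]
    by_cases hsnd : v = x.snd
    · simp only [g, R.faceNext_fst, if_neg hfst, if_pos hsnd, zero_add]
      rw [hsnd, h.inl_eq_of_isPairedTurn hpaired]
    · simp only [g, R.faceNext_fst, if_neg hfst, if_neg hsnd, h.eq_zero_of_ne x v hfst hsnd,
        add_zero]
  rw [List.map_congr_left fun x => eq_add_next, List.sum_map_add, R.sum_boundaryFrom_faceNext,
    ZModModule.add_self]

theorem sum_boundaryFrom_aux_eq_zero {d : G.Dart} (hd : R.faceOf d = loc a) :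
    ((R.boundaryFrom d).map fun x => u (dartEdge x) (.inr a)).sum = 0 := by
  have hd₁ := (R.faceOf_faceNext _).trans hd
  have hd₂ := (R.faceOf_faceNext _).trans hd₁
  have hd₃ := (R.faceOf_faceNext _).trans hd₂
  have hclosed := Function.isPeriodicPt_minimalPeriod R.faceNext d
  rw [RotationSystem.boundaryFrom]
  obtain hn | hn := h.minimalPeriod_eq_three_or_four ha hd <;> rw [hn] at hclosed ⊢ <;>
    simp only [List.iterate, List.map_cons, List.map_nil, List.sum_cons, List.sum_nil, add_zero]
  · have h₂₀ := h.symp_faceNext_eq_one ha hd₂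
    rw [show R.faceNext (R.faceNext (R.faceNext d)) = d from hclosed] at h₂₀
    rw [← add_assoc]
    exact PauliVec.add_add_eq_zero_of_symp_eq_one (h.symp_faceNext_eq_one ha hd)
      (h.symp_faceNext_eq_one ha hd₁) h₂₀
  · have h₄ : R.faceNext (R.faceNext (R.faceNext (R.faceNext d))) = d := hclosed
    have h₃ : R.faceNext (R.faceNext (R.faceNext d)) ≠ d := fun h₃ =>
      R.faceNext_ne d (by rwa [h₃] at h₄)
    have eq₀₂ := h.aux_eq_of_not_consecutive ha hd hd₂ (ha _ hd).faceNext_faceNext_ne.symm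
      (R.faceNext_ne _).symm h₃
    have eq₁₃ := h.aux_eq_of_not_consecutive ha hd₁ hd₃ (ha _ hd₁).faceNext_faceNext_ne.symm
      (R.faceNext_ne _).symm (h₄.trans_ne (R.faceNext_ne d).symm)
    rw [eq₀₂, eq₁₃, ← add_assoc, ZModModule.add_self]

theorem sum_boundaryFrom_eq_zero {d : G.Dart} (hd : R.faceOf d = loc a) :
    ((R.boundaryFrom d).map fun x => u (dartEdge x)).sum = 0 := by
  funext q
  refine (map_list_sum (Pi.evalAddMonoidHom (fun _ => PauliVec) q) _).trans ?_
  rw [List.map_map, Pi.zero_apply]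
  obtain v | b := q
  · exact h.sum_boundaryFrom_inl_eq_zero ha hd v
  obtain rfl | hb := eq_or_ne a b
  · exact h.sum_boundaryFrom_aux_eq_zero ha hd
  refine List.sum_eq_zero fun y hy => ?_
  obtain ⟨x, hx, rfl⟩ := List.mem_map.1 hy
  by_contra hne
  exact hb (h.aux_unique _ _ _ (h.aux_ne_zero ha ((R.mem_boundaryFrom.1 hx).trans hd)) hne)

end IsWeightThreeSystem

/-! ### Encodings -/

theorem encard_le_encard_of_linearIndepOn {k H N : Type*} [DivisionRing k] [Group H]
    [AddCommGroup N] [Module k N] (φ : Additive H →+ N) {S T : Set H}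
    (hS : LinearIndepOn k (fun x => φ (.ofMul x)) S) (hST : S ⊆ Subgroup.closure T) :
    S.encard ≤ T.encard := by
  have mem_span {x : H} (hx : x ∈ Subgroup.closure T) :
      φ (.ofMul x) ∈ Submodule.span k ((fun x => φ (.ofMul x)) '' T) := by
    induction hx using Subgroup.closure_induction with
    | mem x hx => exact Submodule.subset_span (Set.mem_image_of_mem _ hx)
    | one =>
      rw [ofMul_one, map_zero]
      exact zero_mem _
    | mul x y _ _ hx hy =>
      rw [ofMul_mul, map_add]
      exact add_mem hx hy
    | inv x _ hx =>
      rw [ofMul_inv, map_neg]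
      exact neg_mem hx
  have span_le : Submodule.span k ((fun x => φ (.ofMul x)) '' S) ≤
      Submodule.span k ((fun x => φ (.ofMul x)) '' T) :=
    Submodule.span_le.2 (Set.image_subset_iff.2 fun _ hx => mem_span (hST hx))
  rw [← toENat_rank_span_set hS]
  exact (Cardinal.toENat.monotone' ((Submodule.rank_mono span_le).trans (rank_span_le _))).trans
    (Set.encard_image_le _ _)

namespace RotationSystem

variable {V : Type*} {G : SimpleGraph V} {R : RotationSystem G}

theorem IsFaceCycle.exists_eq_faceCycle {f : R.Face} {c : EVGroup.cycleGroup G}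
    (hc : R.IsFaceCycle f (c : EVGroup G)) : ∃ d, R.faceOf d = f ∧ R.faceCycle d = c := by
  obtain ⟨d, hd, hcd⟩ := hc
  exact ⟨d, hd, Subtype.ext hcd.symm⟩

open scoped Classical in
theorem IsFaceCycle.cycleClass_eq [Finite G.Dart] {f : R.Face} {c : EVGroup.cycleGroup G}
    (hc : R.IsFaceCycle f (c : EVGroup G)) :
    cycleClass G (.ofMul c) = R.faceBdry (Pi.single f 1) := by
  obtain ⟨d, rfl, rfl⟩ := hc.exists_eq_faceCycle
  exact R.cycleClass_faceCycle d

end RotationSystem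

namespace IsFermionicEncoding

variable {V Q : Type*} [Fintype Q] [DecidableEq Q] {G : SimpleGraph V}
  {σ : EVGroup G →* QubitOp Q} (h : IsFermionicEncoding σ)
include h

theorem map_phase_two : σ (EVGroup.phase G 2) = -1 := by
  rw [h.map_phase, show (2 : ZMod 4).val = 2 from rfl, Complex.I_sq, neg_one_smul]

theorem phase_two_notMem_cycleGroup : EVGroup.phase G 2 ∉ EVGroup.cycleGroup G :=
  fun hmem => h.map_cycle_ne _ hmem h.map_phase_two

theorem pauliVecHom_phase (k : ZMod 4) :
    pauliVecHom h.isPauliOp (.ofMul (EVGroup.phase G k)) = 0 :=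
  pauliVecHom_eq_zero _ (h.map_phase k)

theorem map_eq_one_iff {c : EVGroup G} (hc : c ∈ EVGroup.cycleGroup G) :
    σ c = 1 ↔ pauliVecHom h.isPauliOp (.ofMul c) = 0 := by
  refine ⟨fun hone => pauliVecHom_eq_zero _ (hone.trans (one_smul ℂ 1).symm), fun hzero => ?_⟩
  obtain ⟨k, hk⟩ := exists_eq_smul_one_of_pauliVecHom_eq_zero _ hzero
  obtain ⟨j, rfl | rfl⟩ := k.even_or_odd'
  · rw [pow_mul, Complex.I_sq] at hk
    obtain hj | hj := neg_one_pow_eq_or ℂ j <;> rw [hj] at hk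
    · rw [hk, one_smul]
    · exact (h.map_cycle_ne c hc (hk.trans (neg_one_smul ℂ 1))).elim
  · refine (h.map_cycle_ne (c ^ 2) (pow_mem hc 2) ?_).elim
    rw [map_pow, hk, smul_pow, one_pow, ← pow_mul, pow_mul', Complex.I_sq,
      (odd_two_mul_add_one j).neg_one_pow, neg_one_smul]

/-- The class up to phase of the Pauli operator that represents an edge. -/
noncomputable def edgePauliVec : G.edgeSet → Q → PauliVec := fun e =>
  pauliVecHom h.isPauliOp (.ofMul (EVGroup.edge G (edgeDart e)))

theorem edgePauliVec_dartEdge (d : G.Dart) :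
    h.edgePauliVec (dartEdge d) = pauliVecHom h.isPauliOp (.ofMul (EVGroup.edge G d)) :=
  map_edge_edgeDart h.pauliVecHom_phase d

theorem mem_encodingKernel_iff [Fintype G.edgeSet] {c : EVGroup.cycleGroup G} :
    c ∈ encodingKernel σ ↔ ∑ e, cycleClass G (.ofMul c) e • h.edgePauliVec e = 0 := by
  refine (h.map_eq_one_iff c.2).trans ?_
  rw [← edgeLinear_edgeClass h.pauliVecHom_phase c.2, edgeLinear,
    Module.Basis.constr_apply_fintype]
  rfl

theorem linearIndepOn_kernelFaceCycles [Finite V] (hG : G.Connected) (E : PlaneEmbedding G) :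
    LinearIndepOn (ZMod 2) (fun c => cycleClass G (.ofMul c)) (kernelFaceCycles E σ) := by
  classical
  refine ((E.linearIndepOn_faceBdry_single hG E.outer).id_image.mono ?_).comp_of_image
    (cycleClass_injective h.phase_two_notMem_cycleGroup).injOn
  rintro _ ⟨c, ⟨-, f, hf, hc⟩, rfl⟩
  exact ⟨f, hf, hc.cycleClass_eq.symm⟩

theorem encard_kernelFaceCycles_le [Finite V] (hG : G.Connected) (E : PlaneEmbedding G)
    {T : Set (EVGroup.cycleGroup G)} (hT : Subgroup.closure T = encodingKernel σ) :
    (kernelFaceCycles E σ).encard ≤ T.encard :=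
  encard_le_encard_of_linearIndepOn _ (h.linearIndepOn_kernelFaceCycles hG E)
    fun _ hc => hT ▸ hc.1

theorem closure_ne_of_ssubset [Finite V] (hG : G.Connected) (E : PlaneEmbedding G)
    {T : Set (EVGroup.cycleGroup G)} (hT : T ⊂ kernelFaceCycles E σ) :
    Subgroup.closure T ≠ encodingKernel σ := by
  have : Finite (EVGroup.cycleGroup G) :=
    Finite.of_injective (fun c => cycleClass G (.ofMul c))
      (cycleClass_injective h.phase_two_notMem_cycleGroup)
  have lt : T.encard < (kernelFaceCycles E σ).encard := T.toFinite.encard_lt_encard hT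
  exact fun hcl => lt.not_ge (h.encard_kernelFaceCycles_le hG E hcl)

end IsFermionicEncoding

namespace IsWeightThreePlanarEncoding

variable {V A : Type*} [Fintype V] [DecidableEq V] [Fintype A] [DecidableEq A]
  {G : SimpleGraph V} {E : PlaneEmbedding G} {loc : A → E.Face} {σ : EVGroup G →* QubitOp (V ⊕ A)}
  (h : IsWeightThreePlanarEncoding E loc σ) (hsimple : ∀ a, E.IsSimpleFace (loc a))
include h hsimple

theorem isWeightThreeSystem :
    IsWeightThreeSystem E.toRotationSystem loc h.edgePauliVec := by
  have edge_vec (d : G.Dart) : ∃ P : V ⊕ A → Pauli,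
      (∀ q, h.edgePauliVec (dartEdge d) q = (P q).vec) ∧
      (P (.inl d.snd) = .X ∨ P (.inl d.snd) = .Y) ∧
      (∀ v, v ≠ d.fst → v ≠ d.snd → P (.inl v) = .I) ∧
      (∀ a, P (.inr a) ≠ .I → E.Adjacent d (loc a)) ∧
      (∀ a b, P (.inr a) ≠ .I → P (.inr b) ≠ .I → a = b) := by
    obtain ⟨k, P, hP, -, hrest⟩ := h.edge_op d
    exact ⟨P, congrFun ((h.edgePauliVec_dartEdge d).trans (pauliVecHom_eq _ hP)), hrest⟩
  refine ⟨h.loc_injective, hsimple, fun d => ?_, fun d v hfst hsnd => ?_, fun d a ha => ?_,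
    fun e a b ha hb => ?_, fun d d' h₁ h₂ h₃ h₄ => ?_, fun d d' hd hne => ?_⟩
  · obtain ⟨P, hP, hX | hY, -⟩ := edge_vec d
    · rw [hP, hX]; rfl
    · rw [hP, hY]; rfl
  · obtain ⟨P, hP, -, hI, -⟩ := edge_vec d
    rw [hP, hI v hfst hsnd]; rfl
  · obtain ⟨P, hP, -, -, hadj, -⟩ := edge_vec d
    rw [hP, Ne, Pauli.vec_eq_zero_iff] at ha
    exact hadj a ha
  · obtain ⟨d, rfl⟩ := dartEdge_surjective e
    obtain ⟨P, hP, -, -, -, hunique⟩ := edge_vec d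
    rw [hP, Ne, Pauli.vec_eq_zero_iff] at ha hb
    exact hunique a b ha hb
  · rw [h.edgePauliVec_dartEdge, h.edgePauliVec_dartEdge]
    refine sympForm_pauliVecHom _ ?_
    rw [signChar_zero, one_smul, ← map_mul, ← map_mul, EVGroup.edge_commute h₁ h₂ h₃ h₄]
  · rw [h.edgePauliVec_dartEdge, h.edgePauliVec_dartEdge]
    refine sympForm_pauliVecHom _ ?_
    rw [signChar_one, neg_one_smul, ← map_mul, ← map_mul,
      EVGroup.edge_mul_edge_of_snd_eq_fst hd hne, map_mul, h.map_phase_two, neg_one_mul]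

theorem isPairedTurn_of_mem_encodingKernel (hG : G.Connected) {c : EVGroup.cycleGroup G}
    (hc : c ∈ encodingKernel σ) {s : E.Face → ZMod 2} (hs₀ : s E.outer = 0)
    (hs : E.faceBdry s = cycleClass G (.ofMul c)) {d : G.Dart} (hd : s (E.faceOf d) ≠ 0) :
    E.IsPairedTurn loc h.edgePauliVec d := by
  have := Fintype.ofFinite G.edgeSet
  rw [h.mem_encodingKernel_iff, ← hs] at hc
  exact (h.isWeightThreeSystem hsimple).isPairedTurn_of_apply_faceOf_ne_zero hc hG h.loc_bounded
    hs₀ hd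

theorem faceCycle_mem_encodingKernel {d : G.Dart}
    (hd : ∀ x, E.faceOf x = E.faceOf d → E.IsPairedTurn loc h.edgePauliVec x) :
    E.faceCycle d ∈ encodingKernel σ := by
  have := Fintype.ofFinite G.edgeSet
  obtain ⟨a, ha, -⟩ := hd d rfl
  refine (h.map_eq_one_iff (E.faceCycle d).2).2 ?_
  rw [RotationSystem.faceCycle, map_loopElement h.pauliVecHom_phase]
  simp only [← h.edgePauliVec_dartEdge]
  exact (h.isWeightThreeSystem hsimple).sum_boundaryFrom_eq_zero (ha ▸ hd) ha.symm

theorem closure_kernelFaceCycles (hG : G.Connected) :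
    Subgroup.closure (kernelFaceCycles E σ) = encodingKernel σ := by
  classical
  refine le_antisymm ((Subgroup.closure_le _).2 fun c hc => hc.1) fun c hc => ?_
  obtain ⟨s, hs₀, hs⟩ := E.exists_faceBdry_eq_edgeClass hG c.2
  suffices hmem : E.faceBdry s ∈
      (Subgroup.closure (kernelFaceCycles E σ)).toAddSubgroup.map (cycleClass G) by
    obtain ⟨c', hc', hcc'⟩ := hmem
    exact (cycleClass_injective h.phase_two_notMem_cycleGroup) (hcc'.trans hs) ▸ hc'
  have := Fintype.ofFinite E.Face
  rw [← Finset.univ_sum_single s, map_sum]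
  refine sum_mem fun f _ => ?_
  by_cases hf : s f = 0
  · rw [hf, Pi.single_zero, map_zero]
    exact zero_mem _
  have hf₀ : f ≠ E.outer := fun heq => hf (heq ▸ hs₀)
  have : Nontrivial V := not_subsingleton_iff_nontrivial.1 fun _ =>
    hf₀ (E.subsingleton_face.elim _ _)
  obtain ⟨d, rfl⟩ := E.exists_faceOf_eq_of_nontrivial hG f
  have hmem : E.faceCycle d ∈ encodingKernel σ :=
    h.faceCycle_mem_encodingKernel hsimple fun x hx =>
      h.isPairedTurn_of_mem_encodingKernel hsimple hG hc hs₀ hs (hx ▸ hf)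
  have hgen : E.faceCycle d ∈ Subgroup.closure (kernelFaceCycles E σ) :=
    Subgroup.subset_closure ⟨hmem, _, hf₀, d, rfl, rfl⟩
  have hone : s (E.faceOf d) = 1 := Fin.eq_one_of_ne_zero _ hf
  exact ⟨.ofMul (E.faceCycle d), hgen, by rw [E.cycleClass_faceCycle, hone]⟩

theorem sides_eq_three_or_four (hG : G.Connected) {f : E.Face} (hf : f ≠ E.outer)
    {c : EVGroup.cycleGroup G} (hc : c ∈ encodingKernel σ)
    (hcf : E.IsFaceCycle f (c : EVGroup G)) : E.sides f = 3 ∨ E.sides f = 4 := by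
  classical
  have hs := hcf.cycleClass_eq.symm
  obtain ⟨d, rfl, -⟩ := hcf
  have hpaired (x : G.Dart) (hx : E.faceOf x = E.faceOf d) :
      E.IsPairedTurn loc h.edgePauliVec x := by
    refine h.isPairedTurn_of_mem_encodingKernel hsimple hG hc (Pi.single_eq_of_ne hf.symm 1) hs ?_
    rw [hx, Pi.single_eq_same]
    exact one_ne_zero
  obtain ⟨a, ha, -⟩ := hpaired d rfl
  rw [E.sides_faceOf]
  exact (h.isWeightThreeSystem hsimple).minimalPeriod_eq_three_or_four (ha ▸ hpaired) ha.symm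

end IsWeightThreePlanarEncoding

theorem mainTheorem4 {V A : Type*} [Fintype V] [DecidableEq V] [Fintype A] [DecidableEq A]
    (G : SimpleGraph V) (hG : G.Connected) (E : PlaneEmbedding G) (loc : A → E.Face)
    (σ : EVGroup G →* QubitOp (V ⊕ A)) (hσ : IsWeightThreePlanarEncoding E loc σ)
    (hsimple : ∀ a, E.IsSimpleFace (loc a)) :
    -- the face cycles in the kernel generate it
    Subgroup.closure (kernelFaceCycles E σ) = encodingKernel σ ∧
    -- none of them can be left out
    (∀ T : Set (EVGroup.cycleGroup G), T ⊂ kernelFaceCycles E σ →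
      Subgroup.closure T ≠ encodingKernel σ) ∧
    -- and no generating set of the kernel has fewer elements
    (∀ T : Set (EVGroup.cycleGroup G), Subgroup.closure T = encodingKernel σ →
      (kernelFaceCycles E σ).encard ≤ T.encard) ∧
    -- the face cycles in the kernel are around faces with three or four sides
    (∀ f : E.Face, f ≠ E.outer → ∀ c ∈ encodingKernel σ, E.IsFaceCycle f (c : EVGroup G) →
      E.sides f = 3 ∨ E.sides f = 4) := by
  have enc := hσ.toIsFermionicEncoding
  refine ⟨?generate, ?minimal, ?fewest, ?sides⟩
  case generate => exact hσ.closure_kernelFaceCycles hsimple hG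
  case minimal => exact fun T hT => enc.closure_ne_of_ssubset hG E hT
  case fewest => exact fun T hT => enc.encard_kernelFaceCycles_le hG E hT
  case sides => exact fun f hf c hc hcf => hσ.sides_eq_three_or_four hsimple hG hf hc hcf
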